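/- **Theorem (Consistency).** Let $n\in\mathbb N$, $a<b$, and let $f:\mathbb R^n\times[a,b]\to\mathbb R^n$ be continuous and locally Lipschitz in its first argument uniformly in the parameter: for every $R>0$ there is $L_R>0$ with $\|f(u_1,\mu)-f(u_2,\mu)\|\le L_R\|u_1-u_2\|$ for all $\|u_1\|,\|u_2\|\le R$ and $\mu\in[a,b]$. Let $\bar\mu$ and $\sigma$ be the mean and the standard deviation of the uniform distribution on $[a,b]$, so that $z\mapsto\bar\mu+\sigma z$ maps $I_\xi=[-\sqrt3,\sqrt3]$ onto $[a,b]$. For $v:I_\xi\to\mathbb R^n$ put $\mathcal F(v)(z)=f(v(z),\bar\mu+\sigma z)$. Let $\bar u\in C(I_\xi;\mathbb R^n)$ be a (re-parametrized) solution branch, i.e. $\mathcal F(\bar u)(z)=0$ for all $z\in I_\xi$, and assume $\bar u\in H^s(I_\xi;\mathbb R^n)$ for a real number $s\ge1$. (For real $s\ge 1$ with $m=\lfloor s\rfloor$, $H^s$ consists of the functions whose weak derivatives of order $\le m$ lie in $L^2$ and, if $s>m$, whose $m$-th weak derivative $g$ satisfies $\iint_{I_\xi^2}\|g(x)-g(y)\|^2|x-y|^{-1-2(s-m)}\,dx\,dy<\infty$.)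 Let $\Phi_k(z)=P_k(z/\sqrt3)$, where $P_k$ is the $k$-th Legendre polynomial, let $\langle v,\Phi_k\rangle_{L^2}=\int_{I_\xi}v(z)\Phi_k(z)\,dz\in\mathbb R^n$, and let $$u_{LS,N}=\sum_{k=0}^N\frac{\langle\bar u,\Phi_k\rangle_{L^2}}{\|\Phi_k\|_{L^2}^2}\,\Phi_k .$$ Let $\|\cdot\|_{L^2}$ and $\|\cdot\|_{L^\infty}$ be the norms over $I_\xi$ with respect to Lebesgue measure and the Euclidean norm of $\mathbb R^n$. Then, for every $N\ge 0$, $u_{LS,N}$ is a best approximation of $\bar u$ in $L^2(I_\xi;\mathbb R^n)$ by $\mathbb R^n$-valued polynomials of degree at most $N$, and $\mathcal F(u_{LS,N})$ is continuous on $I_\xi$. There are constants $C_\infty,C_2>0$, independent of $N$ (and of $\delta$), such that $$\|\mathcal F(u_{LS,N})\|_{L^\infty}\le C_\infty\|\bar u-u_{LS,N}\|_{L^\infty},\qquad \|\mathcal F(u_{LS,N})\|_{L^2}\le C_2\|\bar u-u_{LS,N}\|_{L^2}\qquad\text{for all }N\ge 0,$$ and, as $N\to\infty$, $$\|\bar u-u_{LS,N}\|_{L^\infty}=\mathcal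 O\big(N^{3/4+\delta-s}\big)\ \text{ for every }\delta>0,\qquad \|\bar u-u_{LS,N}\|_{L^2}=\mathcal O\big(N^{-s}\big),$$ so that also $\|\mathcal F(u_{LS,N})\|_{L^\infty}=\mathcal O(N^{3/4+\delta-s})$ for every $\delta>0$ and $\|\mathcal F(u_{LS,N})\|_{L^2}=\mathcal O(N^{-s})$. In particular, for every $l\in\mathbb N$, $$\lim_{N\to\infty}\langle\mathcal F(u_{LS,N}),\Phi_l\rangle_{L^2}=0\in\mathbb R^n .$$ -/

import Mathlib

open MeasureTheory ProbabilityTheory Filter Topology Set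
open scoped ENNReal ContDiff Polynomial

noncomputable section

namespace PolyChaos

/-- The state space `ℝⁿ` with its Euclidean norm. -/
abbrev E (n : ℕ) : Type := EuclideanSpace ℝ (Fin n)

/-! ### The parameter and its normalization -/

/-- The uniform law `𝒰(a, b)`: normalized Lebesgue measure on `[a, b]`. -/
def uniformLaw (a b : ℝ) : Measure ℝ := ProbabilityTheory.cond volume (Icc a b)

/-- The expectation of the parameter `μ ∼ 𝒰(a, b)`. -/
def paramMean (a b : ℝ) : ℝ := ∫ x, x ∂(uniformLaw a b)

/-- The standard deviation of the parameter `μ ∼ 𝒰(a, b)`. -/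
def paramStd (a b : ℝ) : ℝ :=
  Real.sqrt (∫ x, (x - paramMean a b) ^ 2 ∂(uniformLaw a b))

/-- The range `I_ξ = [-√3, √3]` of the normalized parameter. -/
def Ixi : Set ℝ := Icc (-Real.sqrt 3) (Real.sqrt 3)

theorem integral_uniformLaw {a b : ℝ} (hab : a < b) (g : ℝ → ℝ) :
    ∫ x, g x ∂(uniformLaw a b) = (b - a)⁻¹ * ∫ x in a..b, g x := by
  have h : (ENNReal.ofReal (b - a))⁻¹.toReal = (b - a)⁻¹ := by
    rw [ENNReal.toReal_inv, ENNReal.toReal_ofReal (by linarith)]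
  rw [uniformLaw, ProbabilityTheory.cond, integral_smul_measure, Real.volume_Icc, h,
    intervalIntegral.integral_of_le hab.le, integral_Icc_eq_integral_Ioc, smul_eq_mul]

theorem paramMean_eq {a b : ℝ} (hab : a < b) : paramMean a b = (a + b) / 2 := by
  have h : b - a ≠ 0 := by linarith
  rw [paramMean, integral_uniformLaw hab, integral_id]
  field_simp
  ring

theorem paramStd_eq {a b : ℝ} (hab : a < b) :
    paramStd a b = (b - a) / (2 * Real.sqrt 3) := by
  have h : b - a ≠ 0 := by linarith
  have h3 : Real.sqrt 3 ^ 2 = 3 := Real.sq_sqrt (by norm_num)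
  have h3' : 0 < Real.sqrt 3 := Real.sqrt_pos.2 (by norm_num)
  rw [paramStd, integral_uniformLaw hab, paramMean_eq hab,
    intervalIntegral.integral_comp_sub_right (fun x => x ^ 2), integral_pow]
  rw [Real.sqrt_eq_iff_mul_self_eq_of_pos (by have : 0 < b - a := by linarith
                                              positivity)]
  field_simp
  rw [h3]
  push_cast
  ring

/-! ### Solution branches and the Nemytskii operator -/

/-- The standing assumptions on `f : ℝⁿ × [a, b] → ℝⁿ`: joint continuity, and Lipschitz
continuity in the first variable on bounded sets, uniformly in the parameter. Values of
`f u μ` with `μ` outside `[a, b]` are irrelevant. -/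
structure IsAdmissible {n : ℕ} (a b : ℝ) (f : E n → ℝ → E n) : Prop where
  continuousOn : ContinuousOn (fun p : E n × ℝ => f p.1 p.2) (univ ×ˢ Icc a b)
  locallyLipschitz : ∀ R : ℝ, 0 < R → ∃ L : ℝ, 0 < L ∧
    ∀ u₁ u₂ : E n, ‖u₁‖ ≤ R → ‖u₂‖ ≤ R → ∀ μ ∈ Icc a b,
      ‖f u₁ μ - f u₂ μ‖ ≤ L * ‖u₁ - u₂‖

/-- A solution branch over the whole interval `[a, b]`: a continuous curve of steady states. -/
structure IsSolutionBranch {n : ℕ} (a b : ℝ) (f : E n → ℝ → E n) (u : ℝ → E n) : Prop where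
  continuousOn : ContinuousOn u (Icc a b)
  steady : ∀ μ ∈ Icc a b, f (u μ) μ = 0

/-- The re-parametrization `z ↦ u (μ̄ + σ z)` of a curve over `[a, b]` as a curve over `I_ξ`. -/
def reparam {n : ℕ} (a b : ℝ) (u : ℝ → E n) (z : ℝ) : E n :=
  u (paramMean a b + paramStd a b * z)

/-- The re-parametrized Nemytskii operator `𝓕(v)(z) = f (v z, μ̄ + σ z)`. -/
def nemytskii {n : ℕ} (a b : ℝ) (f : E n → ℝ → E n) (v : ℝ → E n) (z : ℝ) : E n :=
  f (v z) (paramMean a b + paramStd a b * z)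

/-! ### Norms and Sobolev regularity on `I_ξ` -/

/-- The norm of `L²(I_ξ; ℝⁿ)`, with values in `[0, ∞]`. -/
def normL2 {n : ℕ} (v : ℝ → E n) : ℝ≥0∞ := eLpNorm v 2 (volume.restrict Ixi)

/-- The norm of `L^∞(I_ξ; ℝⁿ)` (essential supremum), with values in `[0, ∞]`. -/
def normLinf {n : ℕ} (v : ℝ → E n) : ℝ≥0∞ := eLpNorm v ⊤ (volume.restrict Ixi)

/-- `g` is the weak derivative of order `k` of `v` in the interior of `I_ξ`: for every smooth
`φ` with compact support in the open interval, `∫ φ⁽ᵏ⁾ v = (-1)ᵏ ∫ φ g`. -/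
def IsWeakDeriv {n : ℕ} (k : ℕ) (v g : ℝ → E n) : Prop :=
  ∀ φ : ℝ → ℝ, ContDiff ℝ ∞ φ → HasCompactSupport φ → tsupport φ ⊆ interior Ixi →
    ∫ z in Ixi, iteratedDeriv k φ z • v z = (-1 : ℝ) ^ k • ∫ z in Ixi, φ z • g z

/-- The square of the Gagliardo (Sobolev–Slobodeckij) seminorm of order `θ ∈ (0, 1)` on `I_ξ`. -/
def gagliardoSq {n : ℕ} (θ : ℝ) (g : ℝ → E n) : ℝ≥0∞ :=
  ∫⁻ x in Ixi, ∫⁻ y in Ixi, ENNReal.ofReal (‖g x - g y‖ ^ 2 / |x - y| ^ (1 + 2 * θ))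

/-- Membership in the Sobolev space `H^s(I_ξ; ℝⁿ)` for real `s ≥ 0`: with `m = ⌊s⌋`, the weak
derivatives of order `0, …, m` exist in `L²`, and, if `s` is not an integer, the `m`-th one has a
finite Gagliardo seminorm of order `s - m`. -/
def MemSobolev {n : ℕ} (s : ℝ) (v : ℝ → E n) : Prop :=
  ∃ D : ℕ → ℝ → E n, D 0 = v ∧
    (∀ k ≤ ⌊s⌋₊, MemLp (D k) 2 (volume.restrict Ixi) ∧ IsWeakDeriv k v (D k)) ∧
    ((⌊s⌋₊ : ℝ) < s → gagliardoSq (s - ⌊s⌋₊) (D ⌊s⌋₊) < ⊤)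

/-! ### Legendre polynomials and the least-squares approximation -/

/-- The Legendre polynomial `P_k`, by Rodrigues' formula. -/
def legendre (k : ℕ) : ℝ[X] :=
  Polynomial.C (1 / (2 ^ k * (k.factorial : ℝ))) *
    Polynomial.derivative^[k] ((Polynomial.X ^ 2 - 1) ^ k)

/-- The polynomial chaos basis function `Φ_k(z) = P_k(z / √3)`: the Legendre polynomial
scaled to `I_ξ`. -/
def Phi (k : ℕ) (z : ℝ) : ℝ := (legendre k).eval (z / Real.sqrt 3)

/-- The moment `⟨v, Φ_k⟩_{L²} ∈ ℝⁿ`, taken componentwise. -/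
def moment {n : ℕ} (v : ℝ → E n) (k : ℕ) : E n := ∫ z in Ixi, Phi k z • v z

/-- The degree-`N` least-squares Legendre projection
`∑_{k ≤ N} (⟨v, Φ_k⟩ / ‖Φ_k‖²) Φ_k` of `v`. -/
def lsProj {n : ℕ} (N : ℕ) (v : ℝ → E n) (z : ℝ) : E n :=
  ∑ k ∈ Finset.range (N + 1), Phi k z • ((∫ x in Ixi, Phi k x ^ 2)⁻¹ • moment v k)

/-- The space `Π_Nⁿ` of `ℝⁿ`-valued polynomials of degree at most `N`. -/
def IsPolyOfDegreeLE {n : ℕ} (N : ℕ) (p : ℝ → E n) : Prop :=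
  ∀ i : Fin n, ∃ q : ℝ[X], q.natDegree ≤ N ∧ ∀ z, p z i = q.eval z

/-- `p` is a best approximation of `v` in `L²(I_ξ; ℝⁿ)` by polynomials of degree at most `N`. -/
def IsBestL2Approx {n : ℕ} (N : ℕ) (v p : ℝ → E n) : Prop :=
  IsPolyOfDegreeLE N p ∧
    ∀ q : ℝ → E n, IsPolyOfDegreeLE N q →
      normL2 (fun z => v z - p z) ≤ normL2 (fun z => v z - q z)

/-- `e_N = 𝒪(N^r)` as `N → ∞`, for a sequence with values in `[0, ∞]`; in particular `e_N` is
eventually finite. -/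
def IsBigOPow (e : ℕ → ℝ≥0∞) (r : ℝ) : Prop :=
  ∃ K : ℝ, 0 < K ∧ ∀ᶠ N : ℕ in atTop, e N ≤ ENNReal.ofReal (K * (N : ℝ) ^ r)

end PolyChaos

end

namespace PolyChaos

/-! ### Legendre polynomials: differential equation, endpoint values, degree. -/

section LegendreAlgebra

open Polynomial

/-! Since `f` vanishes along the branch, the residual at `z` is a difference of values of `f` at the
same parameter. The projections converge uniformly, so they and the branch lie in one ball, and a
single Lipschitz constant bounds the residual pointwise by the projection error. Both residual
estimates, and the convergence of the moments, then reduce to approximation rates for Legendre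
projections, proved componentwise.

The source of the rates is the Sturm–Liouville equation (wΦ_k')' = -k(k+1)Φ_k with w = 3 - z². As w
vanishes at ±√3, integration by parts produces no boundary terms. This gives orthogonality, and also
a Jackson inequality (`jackson_tail`): for a tail p of the expansion of v, write p = -(wr')' with r
in the span of the same Φ_k, move the derivative onto v, and estimate wr' by the eigenvalues. One
weak derivative thus gains a factor 1/(N+1) in L². Iterating over the integer orders leaves a
fractional remainder, handled by mollifying at scale 1/(N+1) (`exists_smoothing`,
`exists_sqDist_projPoly_le_of_gagliardo`). The result is the L² rate N^{-s}.

For the uniform norm (`sq_sub_eval_projPoly_le`), subtract from u a primitive Q of the projection of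
u', normalized so that d = u - Q has mean zero. Then d' is orthogonal to low-degree polynomials,
hence so is d. Jackson bounds ‖d‖ in L², the inequality |d|² ≤ 2‖d‖‖d'‖ bounds d uniformly, and the
projection of d consists of only two Legendre terms, controlled by |Φ_k| ≤ 1. This yields the rate
N^{1/2-s}, which is stronger than the asserted N^{3/4+δ-s}. -/

theorem iterate_derivative_X_mul_derivative (p : ℝ[X]) (m : ℕ) :
    derivative^[m] (X * derivative p) =
      X * derivative^[m + 1] p + (m : ℝ[X]) * derivative^[m] p := by
  induction m with
  | zero => simp
  | succ m ih =>
    rw [Function.iterate_succ_apply', ih]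
    simp only [derivative_add, derivative_mul, derivative_X, derivative_natCast,
      ← Function.iterate_succ_apply' (f := derivative (R := ℝ))]
    push_cast
    ring

theorem iterate_derivative_succ_X_mul (p : ℝ[X]) (m : ℕ) :
    derivative^[m + 1] (X * p) =
      X * derivative^[m + 1] p + ((m : ℝ[X]) + 1) * derivative^[m] p := by
  induction m with
  | zero => simp; ring
  | succ m ih =>
    rw [Function.iterate_succ_apply', ih]
    simp only [derivative_add, derivative_mul, derivative_X, derivative_natCast, derivative_one,
      ← Function.iterate_succ_apply' (f := derivative (R := ℝ))]
    push_cast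
    ring

/-- Legendre's differential equation for the unnormalized Rodrigues polynomials. -/
theorem rodrigues_ode (k : ℕ) :
    derivative ((1 - X ^ 2) * derivative (derivative^[k] ((X ^ 2 - 1 : ℝ[X]) ^ k))) =
      -((k : ℝ[X]) * ((k : ℝ[X]) + 1)) * derivative^[k] ((X ^ 2 - 1 : ℝ[X]) ^ k) := by
  set y : ℝ[X] := (X ^ 2 - 1) ^ k with hy
  -- The first-order equation (x² - 1)y' = 2kxy, arranged so that the two Leibniz rules above apply.
  -- Differentiating it k + 1 times gives Legendre's equation.
  have h1 : X * (X * derivative y) - derivative y = ((2 * k : ℕ) : ℝ[X]) * (X * y) := by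
    rcases k with _ | k
    · simp [hy]
    · rw [hy, derivative_pow]
      simp only [derivative_sub, derivative_X_pow, derivative_one, Nat.add_sub_cancel]
      simp only [map_natCast]
      push_cast
      ring
  have h2 := congrArg (fun p => derivative^[k + 1] p) h1
  simp only [iterate_derivative_sub, iterate_derivative_natCast_mul,
    iterate_derivative_succ_X_mul, iterate_derivative_X_mul_derivative,
    ← Function.iterate_succ_apply (f := derivative (R := ℝ))] at h2
  simp only [← Function.iterate_succ_apply' (f := derivative (R := ℝ)), derivative_mul,
    derivative_sub, derivative_one, derivative_X_pow, map_natCast]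
  push_cast at h2 ⊢
  linear_combination -h2

/-- In Leibniz's formula only the term with all k derivatives on the power survives at c. With c =
±1 this evaluates Rodrigues' formula at the endpoints. -/
theorem eval_iterate_derivative_X_sub_C_pow_mul (c : ℝ) (q : ℝ[X]) (k : ℕ) :
    (derivative^[k] ((X - C c) ^ k * q)).eval c = k.factorial * q.eval c := by
  rw [iterate_derivative_mul, eval_finsetSum, Finset.sum_eq_single 0]
  · simp [iterate_derivative_X_sub_pow_self]
  · intro j hj hj0
    rw [iterate_derivative_X_sub_pow]
    have hjk : j ≤ k := by simpa [Nat.lt_succ_iff] using hj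
    have : k - (k - j) ≠ 0 := by omega
    simp [this]
  · simp

theorem legendre_ode (k : ℕ) :
    derivative ((1 - X ^ 2) * derivative (legendre k)) =
      -((k : ℝ[X]) * ((k : ℝ[X]) + 1)) * legendre k := by
  rw [legendre, derivative_C_mul, mul_left_comm, derivative_C_mul, rodrigues_ode]
  ring

theorem eval_one_legendre (k : ℕ) : (legendre k).eval 1 = 1 := by
  have h : (X ^ 2 - 1 : ℝ[X]) ^ k = (X - C 1) ^ k * (X + 1) ^ k := by
    rw [← mul_pow, C_1]; ring
  rw [legendre, eval_mul, eval_C, h, eval_iterate_derivative_X_sub_C_pow_mul]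
  have : (k.factorial : ℝ) ≠ 0 := by positivity
  simp only [eval_pow, eval_add, eval_X, eval_one]
  norm_num
  field_simp

theorem eval_neg_one_legendre (k : ℕ) : (legendre k).eval (-1) = (-1) ^ k := by
  have h : (X ^ 2 - 1 : ℝ[X]) ^ k = (X - C (-1)) ^ k * (X - 1) ^ k := by
    rw [← mul_pow, C_neg, C_1]; ring
  rw [legendre, eval_mul, eval_C, h, eval_iterate_derivative_X_sub_C_pow_mul]
  have : (k.factorial : ℝ) ≠ 0 := by positivity
  simp only [eval_pow, eval_sub, eval_X, eval_one]
  norm_num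
  rw [show (-2 : ℝ) = (-1) * 2 by norm_num, mul_pow]
  field_simp

theorem degree_legendre (k : ℕ) : (legendre k).degree = k := by
  have hd : ((X ^ 2 - 1 : ℝ[X]) ^ k).natDegree = 2 * k := by
    rw [natDegree_pow, ← C_1, natDegree_X_pow_sub_C, mul_comm]
  have hm : ((X ^ 2 - 1 : ℝ[X]) ^ k).Monic := by
    rw [← C_1]
    exact (monic_X_pow_sub_C 1 two_ne_zero).pow k
  have hc : (legendre k).coeff k ≠ 0 := by
    rw [legendre, coeff_C_mul, coeff_iterate_derivative, ← two_mul, ← hd, hm.coeff_natDegree]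
    have : 0 < (2 * k).descFactorial k := Nat.descFactorial_pos.2 (by omega)
    rw [hd]
    have h2 : ((2 * k).descFactorial k : ℝ) ≠ 0 := by exact_mod_cast this.ne'
    simp only [nsmul_eq_mul, mul_one]
    positivity
  refine le_antisymm ?_ (le_degree_of_ne_zero hc)
  rw [degree_le_iff_coeff_zero]
  intro j hj
  have hj : k < j := by exact_mod_cast hj
  rw [legendre, coeff_C_mul, coeff_iterate_derivative, coeff_eq_zero_of_natDegree_lt (by omega)]
  simp

/-- The scaled Legendre polynomial `Φ_k` as an element of `ℝ[X]`. -/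
noncomputable def phiPoly (k : ℕ) : ℝ[X] := (legendre k).comp (C (Real.sqrt 3)⁻¹ * X)

theorem eval_phiPoly (k : ℕ) (z : ℝ) : (phiPoly k).eval z = Phi k z := by
  simp [phiPoly, Phi, div_eq_inv_mul]

theorem degree_phiPoly (k : ℕ) : (phiPoly k).degree = k := by
  have h3 : (Real.sqrt 3)⁻¹ ≠ 0 := by positivity
  have hn : (legendre k).natDegree = k := natDegree_eq_of_degree_eq_some (degree_legendre k)
  have h0 : phiPoly k ≠ 0 := by
    intro h
    have h1 := eval_phiPoly k (Real.sqrt 3)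
    rw [h, Phi, div_self (by positivity), eval_one_legendre, eval_zero] at h1
    norm_num at h1
  rw [degree_eq_natDegree h0, phiPoly, natDegree_comp, hn, natDegree_C_mul_X _ h3, mul_one]

theorem natDegree_phiPoly (k : ℕ) : (phiPoly k).natDegree = k :=
  natDegree_eq_of_degree_eq_some (degree_phiPoly k)

theorem phiPoly_ode (k : ℕ) :
    derivative ((C 3 - X ^ 2) * derivative (phiPoly k)) =
      -((k : ℝ[X]) * ((k : ℝ[X]) + 1)) * phiPoly k := by
  have h3 : (Real.sqrt 3)⁻¹ * (Real.sqrt 3)⁻¹ = 3⁻¹ := by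
    rw [← mul_inv, Real.mul_self_sqrt (by norm_num)]
  have hsub : (C 3 - X ^ 2 : ℝ[X]) = C 3 * (1 - X ^ 2 : ℝ[X]).comp (C (Real.sqrt 3)⁻¹ * X) := by
    simp only [sub_comp, one_comp, X_pow_comp, mul_pow, mul_sub, mul_one, ← mul_assoc, ← C_pow,
      ← C_mul, pow_two (Real.sqrt 3)⁻¹, h3]
    norm_num
  have hc : (C 3 * C (Real.sqrt 3)⁻¹ * C (Real.sqrt 3)⁻¹ : ℝ[X]) = 1 := by
    rw [mul_assoc, ← C_mul, h3, ← C_mul]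
    norm_num
  have key := congrArg (fun p => p.comp (C (Real.sqrt 3)⁻¹ * X)) (legendre_ode k)
  rw [phiPoly, derivative_comp, hsub, derivative_C_mul, derivative_X, mul_one]
  rw [show C 3 * (1 - X ^ 2 : ℝ[X]).comp (C (Real.sqrt 3)⁻¹ * X) * (C (Real.sqrt 3)⁻¹ *
      (derivative (legendre k)).comp (C (Real.sqrt 3)⁻¹ * X)) = C (3 * (Real.sqrt 3)⁻¹) *
      ((1 - X ^ 2) * derivative (legendre k)).comp (C (Real.sqrt 3)⁻¹ * X) by
    rw [mul_comp, C_mul]; ring]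
  rw [derivative_C_mul, derivative_comp, key, derivative_C_mul, derivative_X, mul_one, mul_comp,
    C_mul, mul_mul_mul_comm, ← mul_assoc (C 3 * C _), ← mul_assoc, hc]
  simp

end LegendreAlgebra

/-! ### Orthogonality, norms and the uniform bound of the scaled Legendre polynomials -/

section LegendreIntegrals

open Polynomial

theorem sqrt_three_pos : 0 < Real.sqrt 3 := Real.sqrt_pos.2 (by norm_num)

theorem sqrt_three_sq : Real.sqrt 3 ^ 2 = 3 := Real.sq_sqrt (by norm_num)

theorem neg_sqrt_three_le : -Real.sqrt 3 ≤ Real.sqrt 3 := by linarith [sqrt_three_pos]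

theorem sq_le_three {z : ℝ} (hz : z ∈ Ixi) : z ^ 2 ≤ 3 := by
  rw [← sqrt_three_sq]
  exact sq_le_sq' hz.1 hz.2

theorem setIntegral_Ixi (f : ℝ → ℝ) :
    ∫ z in Ixi, f z = ∫ z in (-Real.sqrt 3)..Real.sqrt 3, f z := by
  rw [Ixi, integral_Icc_eq_integral_Ioc, intervalIntegral.integral_of_le neg_sqrt_three_le]

theorem _root_.ContinuousOn.integrable_Ixi {F : Type*} [NormedAddCommGroup F] {f : ℝ → F}
    (hf : ContinuousOn f Ixi) : Integrable f (volume.restrict Ixi) :=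
  hf.integrableOn_compact isCompact_Icc

theorem integrable_eval (p : ℝ[X]) : Integrable (fun z => p.eval z) (volume.restrict Ixi) :=
  p.continuous.continuousOn.integrable_Ixi

/-- Integration over `I_ξ` as a linear functional on polynomials. -/
noncomputable def polyIntegral : ℝ[X] →ₗ[ℝ] ℝ where
  toFun p := ∫ z in Ixi, p.eval z
  map_add' p q := by
    simp only [eval_add]
    exact integral_add (integrable_eval p) (integrable_eval q)
  map_smul' c p := by
    simp only [eval_smul, smul_eq_mul, RingHom.id_apply]
    exact integral_const_mul _ _

theorem polyIntegral_apply (p : ℝ[X]) : polyIntegral p = ∫ z in Ixi, p.eval z := rfl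

theorem polyIntegral_derivative (p : ℝ[X]) :
    polyIntegral (derivative p) = p.eval (Real.sqrt 3) - p.eval (-Real.sqrt 3) := by
  rw [polyIntegral_apply, setIntegral_Ixi]
  exact intervalIntegral.integral_eq_sub_of_hasDerivAt (fun x _ => p.hasDerivAt x)
    ((derivative p).continuous.intervalIntegrable _ _)

theorem polyIntegral_C_mul (c : ℝ) (p : ℝ[X]) : polyIntegral (C c * p) = c * polyIntegral p := by
  rw [← smul_eq_C_mul, map_smul, smul_eq_mul]

/-- The weight `3 - z²` of the Sturm–Liouville operator on `I_ξ`. -/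
noncomputable def weight : ℝ[X] := C 3 - X ^ 2

theorem eval_weight (z : ℝ) : weight.eval z = 3 - z ^ 2 := by simp [weight]

theorem eval_weight_sqrt : weight.eval (Real.sqrt 3) = 0 := by
  rw [eval_weight, sqrt_three_sq, sub_self]

theorem eval_weight_neg_sqrt : weight.eval (-Real.sqrt 3) = 0 := by
  rw [eval_weight, neg_sq, sqrt_three_sq, sub_self]

theorem weight_phiPoly_ode (k : ℕ) :
    derivative (weight * derivative (phiPoly k)) = C (-((k : ℝ) * (k + 1))) * phiPoly k := by
  rw [weight, phiPoly_ode]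
  simp

/-- Integration by parts; the boundary term disappears because the weight vanishes at ±√3. -/
theorem polyIntegral_sturm (p q : ℝ[X]) :
    polyIntegral (derivative (weight * derivative p) * q) =
      -polyIntegral (weight * derivative p * derivative q) := by
  have h := polyIntegral_derivative (weight * derivative p * q)
  rw [derivative_mul, map_add] at h
  simp only [eval_mul, eval_weight_sqrt, eval_weight_neg_sqrt, zero_mul, sub_zero] at h
  linarith

/-- The Sturm–Liouville operator is symmetric, and the eigenvalues j(j+1) and k(k+1) differ by
(j-k)(j+k+1). -/
theorem polyIntegral_phiPoly_mul {j k : ℕ} (hjk : j ≠ k) :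
    polyIntegral (phiPoly j * phiPoly k) = 0 := by
  have h1 := polyIntegral_sturm (phiPoly j) (phiPoly k)
  have h2 := polyIntegral_sturm (phiPoly k) (phiPoly j)
  rw [weight_phiPoly_ode, mul_assoc, polyIntegral_C_mul] at h1 h2
  rw [mul_right_comm] at h2
  rw [mul_comm (phiPoly k) (phiPoly j)] at h2
  have h3 : ((j : ℝ) - k) * (j + k + 1) * polyIntegral (phiPoly j * phiPoly k) = 0 := by
    linear_combination h2 - h1
  have h4 : ((j : ℝ) - k) ≠ 0 := sub_ne_zero.2 (by exact_mod_cast hjk)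
  have h5 : (j : ℝ) + k + 1 ≠ 0 := by positivity
  simpa [h4, h5] using h3

/-- The scaled Legendre polynomials as a polynomial sequence. -/
noncomputable def phiSequence : Polynomial.Sequence ℝ := ⟨phiPoly, degree_phiPoly⟩

theorem mem_span_phiPoly {p : ℝ[X]} {N : ℕ} (hp : p.natDegree ≤ N) :
    p ∈ Submodule.span ℝ (phiPoly '' Set.Iic N) := by
  have h := phiSequence.span_degreeLE (m := N)
    (fun i _ => (leadingCoeff_ne_zero.2 (phiSequence.ne_zero i)).isUnit)
  change p ∈ Submodule.span ℝ (phiSequence '' Set.Iic N)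
  rw [h, mem_degreeLE]
  exact natDegree_le_iff_degree_le.1 hp

theorem polyIntegral_mul_phiPoly_of_lt {p : ℝ[X]} {k : ℕ} (hp : p.natDegree < k) :
    polyIntegral (p * phiPoly k) = 0 := by
  have h := mem_span_phiPoly (N := k - 1) (p := p) (by omega)
  have hk : 0 < k := by omega
  clear hp
  induction h using Submodule.span_induction with
  | mem x hx =>
    obtain ⟨j, hj, rfl⟩ := hx
    have := Set.mem_Iic.1 hj
    exact polyIntegral_phiPoly_mul (by omega)
  | zero => simp
  | add x y _ _ hx hy => rw [add_mul, map_add, hx, hy, add_zero]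
  | smul c x _ hx => rw [smul_mul_assoc, map_smul, hx, smul_zero]

theorem eval_phiPoly_sqrt (k : ℕ) : (phiPoly k).eval (Real.sqrt 3) = 1 := by
  rw [eval_phiPoly, Phi, div_self sqrt_three_pos.ne', eval_one_legendre]

theorem eval_phiPoly_neg_sqrt (k : ℕ) : (phiPoly k).eval (-Real.sqrt 3) = (-1) ^ k := by
  rw [eval_phiPoly, Phi, neg_div, div_self sqrt_three_pos.ne', eval_neg_one_legendre]

/-- Integrate (zΦ²)' = Φ² + 2zΦΦ'. The leading terms of zΦ' and kΦ cancel, so zΦ' may be replaced by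
kΦ when paired with Φ, and the boundary values give 2√3. -/
theorem polyIntegral_phiPoly_sq (k : ℕ) :
    (2 * k + 1) * polyIntegral (phiPoly k * phiPoly k) = 2 * Real.sqrt 3 := by
  have h := polyIntegral_derivative (X * (phiPoly k * phiPoly k))
  have h1 : ((-1 : ℝ) ^ k) * (-1) ^ k = 1 := by rw [← mul_pow]; norm_num
  simp only [eval_mul, eval_X, eval_phiPoly_sqrt, eval_phiPoly_neg_sqrt, h1] at h
  have h2 : polyIntegral ((X * derivative (phiPoly k) - C (k : ℝ) * phiPoly k) * phiPoly k) = 0 := by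
    rcases k with _ | k
    · have : derivative (phiPoly 0) = 0 :=
        derivative_of_natDegree_zero (natDegree_phiPoly 0)
      simp [this]
    · apply polyIntegral_mul_phiPoly_of_lt
      refine Nat.lt_succ_of_le (natDegree_le_iff_coeff_eq_zero.2 fun j hj => ?_)
      obtain ⟨j, rfl⟩ : ∃ i, j = i + 1 := ⟨j - 1, by omega⟩
      rw [coeff_sub, coeff_X_mul, coeff_derivative, coeff_C_mul]
      rcases Nat.lt_or_ge (k + 1) (j + 1) with hjk | hjk
      · rw [coeff_eq_zero_of_natDegree_lt (by rw [natDegree_phiPoly]; omega)]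
        simp
      · obtain rfl : j = k := by omega
        push_cast
        ring
  have h3 : derivative (X * (phiPoly k * phiPoly k)) = C (2 * (k : ℝ) + 1) * (phiPoly k * phiPoly k)
      + C 2 * ((X * derivative (phiPoly k) - C (k : ℝ) * phiPoly k) * phiPoly k) := by
    simp only [derivative_mul, derivative_X, C_add, C_mul, C_1]
    rw [show (C 2 : ℝ[X]) = 2 from rfl]
    ring
  rw [h3, map_add, polyIntegral_C_mul, polyIntegral_C_mul, h2] at h
  linarith

theorem integral_Phi_sq (k : ℕ) : ∫ z in Ixi, Phi k z ^ 2 = 2 * Real.sqrt 3 / (2 * k + 1) := by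
  rw [eq_div_iff (by positivity), ← polyIntegral_phiPoly_sq k, mul_comm, polyIntegral_apply]
  simp only [eval_mul, eval_phiPoly, sq]

theorem integral_Phi_sq_pos (k : ℕ) : 0 < ∫ z in Ixi, Phi k z ^ 2 := by
  rw [integral_Phi_sq]
  have := sqrt_three_pos
  positivity

/-- The Legendre polynomials are bounded by one on `I_ξ`. -/
theorem abs_Phi_le_one (k : ℕ) {z : ℝ} (hz : z ∈ Ixi) : |Phi k z| ≤ 1 := by
  rcases Nat.eq_zero_or_pos k with rfl | hk
  · simp [Phi, legendre]
  set c : ℝ := (k : ℝ) * (k + 1) with hc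
  have hc0 : 0 < c := by positivity
  -- Sonin's function k(k+1)Φ² + wΦ'². By the differential equation its derivative is 2zΦ'², so on
  -- the interval it is largest at the endpoints, where it equals k(k+1).
  set F : ℝ[X] := C c * (phiPoly k * phiPoly k) +
    weight * (derivative (phiPoly k) * derivative (phiPoly k)) with hF
  have hode := weight_phiPoly_ode k
  have hF' : derivative F = C 2 * (X * (derivative (phiPoly k) * derivative (phiPoly k))) := by
    have hw : derivative weight = -(C 2 * X) := by
      simp [weight, one_add_one_eq_two]
    simp only [derivative_mul, hw, C_neg] at hode
    simp only [hF, derivative_add, derivative_mul, derivative_C, hw]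
    rw [show (C 2 : ℝ[X]) = 2 from rfl] at hode ⊢
    rw [← hc] at hode
    linear_combination 2 * derivative (phiPoly k) * hode
  have hd : ∀ x, HasDerivAt (fun z => F.eval z) (2 * (x * ((derivative (phiPoly k)).eval x *
      (derivative (phiPoly k)).eval x))) x := by
    intro x
    have := F.hasDerivAt x
    rw [hF'] at this
    simpa using this
  have hend : F.eval (Real.sqrt 3) = c ∧ F.eval (-Real.sqrt 3) = c := by
    have h1 : ((-1 : ℝ) ^ k) * (-1) ^ k = 1 := by rw [← mul_pow]; norm_num
    simp [hF, eval_weight_sqrt, eval_weight_neg_sqrt, eval_phiPoly_sqrt, eval_phiPoly_neg_sqrt, h1]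
  have hle : F.eval z ≤ c := by
    rcases le_total 0 z with h0 | h0
    · rw [← hend.1]
      refine monotoneOn_of_deriv_nonneg (convex_Ici (0 : ℝ)) F.continuous.continuousOn
        F.differentiable.differentiableOn ?_ h0 sqrt_three_pos.le hz.2
      intro x hx
      rw [interior_Ici] at hx
      rw [(hd x).deriv]
      have : (0 : ℝ) < x := hx
      have := mul_self_nonneg ((derivative (phiPoly k)).eval x)
      positivity
    · rw [← hend.2]
      refine antitoneOn_of_deriv_nonpos (convex_Iic (0 : ℝ)) F.continuous.continuousOn
        F.differentiable.differentiableOn ?_ (neg_nonpos.2 sqrt_three_pos.le) h0 hz.1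
      intro x hx
      rw [interior_Iic] at hx
      rw [(hd x).deriv]
      have h1 : x < 0 := hx
      have := mul_self_nonneg ((derivative (phiPoly k)).eval x)
      nlinarith [mul_nonneg_of_nonpos_of_nonpos h1.le (neg_nonpos.2 this)]
  have h2 : c * Phi k z ^ 2 ≤ c := by
    refine le_trans ?_ hle
    simp only [hF, eval_add, eval_mul, eval_C, eval_phiPoly, eval_weight]
    nlinarith [mul_nonneg (sub_nonneg.2 (sq_le_three hz))
      (mul_self_nonneg ((derivative (phiPoly k)).eval z))]
  rw [← sq_le_one_iff_abs_le_one]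
  exact le_of_mul_le_mul_left (by simpa using h2) hc0

end LegendreIntegrals

/-! ### L² projection of scalar functions onto polynomials -/

section ScalarProjection

open Polynomial

/-- Lebesgue measure on `I_ξ`. -/
noncomputable abbrev muI : Measure ℝ := volume.restrict Ixi

theorem isCompact_Ixi : IsCompact Ixi := isCompact_Icc

theorem measurableSet_Ixi : MeasurableSet Ixi := measurableSet_Icc

theorem volume_Ixi : volume Ixi = ENNReal.ofReal (2 * Real.sqrt 3) := by
  rw [Ixi, Real.volume_Icc]; ring_nf

instance : IsFiniteMeasure muI :=
  ⟨by rw [Measure.restrict_apply_univ, volume_Ixi]; exact ENNReal.ofReal_lt_top⟩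

theorem _root_.ContinuousOn.memLp_Ixi {F : Type*} [NormedAddCommGroup F] {f : ℝ → F}
    (hf : ContinuousOn f Ixi) (p : ℝ≥0∞) : MemLp f p muI := by
  obtain ⟨C, hC⟩ := isCompact_Ixi.exists_bound_of_continuousOn hf
  exact MemLp.of_bound (hf.aestronglyMeasurable_of_isCompact isCompact_Ixi measurableSet_Ixi) C
    ((ae_restrict_iff' measurableSet_Ixi).2 (Eventually.of_forall hC))

theorem memLp_eval (p : ℝ[X]) : MemLp (fun z => p.eval z) 2 muI :=
  p.continuous.continuousOn.memLp_Ixi 2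

theorem _root_.MeasureTheory.MemLp.integrable_fun_mul {f g : ℝ → ℝ} {μ : Measure ℝ}
    (hf : MemLp f 2 μ) (hg : MemLp g 2 μ) : Integrable (fun z => f z * g z) μ :=
  hf.integrable_mul hg

theorem _root_.MeasureTheory.MemLp.integrable_sub_sq {f g : ℝ → ℝ} {μ : Measure ℝ}
    (hf : MemLp f 2 μ) (hg : MemLp g 2 μ) : Integrable (fun z => (f z - g z) ^ 2) μ :=
  (hf.sub hg).integrable_sq

/-- Cauchy–Schwarz, from the discriminant of the nonnegative quadratic t ↦ ∫ (f + tg)². -/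
theorem sq_integral_mul_le {f g : ℝ → ℝ} {μ : Measure ℝ} (hf : MemLp f 2 μ) (hg : MemLp g 2 μ) :
    (∫ z, f z * g z ∂μ) ^ 2 ≤ (∫ z, f z ^ 2 ∂μ) * ∫ z, g z ^ 2 ∂μ := by
  have hfg := hf.integrable_fun_mul hg
  have h : ∀ t : ℝ, 0 ≤ (∫ z, g z ^ 2 ∂μ) * (t * t) + (2 * ∫ z, f z * g z ∂μ) * t
      + ∫ z, f z ^ 2 ∂μ := by
    intro t
    have h1 : ∫ z, (f z + t * g z) ^ 2 ∂μ = (∫ z, g z ^ 2 ∂μ) * (t * t)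
        + (2 * ∫ z, f z * g z ∂μ) * t + ∫ z, f z ^ 2 ∂μ := by
      have h2 : ∀ z, (f z + t * g z) ^ 2 = ((t * t) * g z ^ 2 + (2 * t) * (f z * g z))
          + f z ^ 2 := fun z => by ring
      simp_rw [h2]
      have h3 : Integrable (fun z => (t * t) * g z ^ 2 + (2 * t) * (f z * g z)) μ :=
        (hg.integrable_sq.const_mul _).add (hfg.const_mul _)
      rw [integral_add h3 hf.integrable_sq,
        integral_add (hg.integrable_sq.const_mul _) (hfg.const_mul _), integral_const_mul,
        integral_const_mul]
      ring
    rw [← h1]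
    exact integral_nonneg fun z => sq_nonneg _
  have := discrim_le_zero h
  rw [discrim] at this
  nlinarith

/-- The moments of a square-integrable function against polynomials, as a linear functional. -/
noncomputable def polyPairing {v : ℝ → ℝ} (hv : MemLp v 2 muI) : ℝ[X] →ₗ[ℝ] ℝ where
  toFun p := ∫ z in Ixi, v z * p.eval z
  map_add' p q := by
    simp only [eval_add, mul_add]
    exact integral_add (hv.integrable_mul (memLp_eval p)) (hv.integrable_mul (memLp_eval q))
  map_smul' c p := by
    simp only [eval_smul, smul_eq_mul, RingHom.id_apply, mul_left_comm _ c]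
    exact integral_const_mul _ _

theorem polyPairing_apply {v : ℝ → ℝ} (hv : MemLp v 2 muI) (p : ℝ[X]) :
    polyPairing hv p = ∫ z in Ixi, v z * p.eval z := rfl

/-- The Legendre coefficient `⟨v, Φ_k⟩ / ‖Φ_k‖²` of a scalar function. -/
noncomputable def legendreCoeff (v : ℝ → ℝ) (k : ℕ) : ℝ :=
  (∫ z in Ixi, Phi k z ^ 2)⁻¹ * ∫ z in Ixi, Phi k z * v z

/-- The Legendre projection of degree `N` of a scalar function, as a polynomial. -/
noncomputable def projPoly (N : ℕ) (v : ℝ → ℝ) : ℝ[X] :=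
  ∑ k ∈ Finset.range (N + 1), C (legendreCoeff v k) * phiPoly k

theorem natDegree_projPoly_le (N : ℕ) (v : ℝ → ℝ) : (projPoly N v).natDegree ≤ N := by
  refine natDegree_sum_le_of_forall_le _ _ fun k hk => ?_
  refine (natDegree_C_mul_le _ _).trans ?_
  rw [natDegree_phiPoly]
  exact Nat.lt_succ_iff.1 (Finset.mem_range.1 hk)

theorem polyIntegral_phiPoly_self (k : ℕ) :
    polyIntegral (phiPoly k * phiPoly k) = ∫ z in Ixi, Phi k z ^ 2 := by
  rw [polyIntegral_apply]
  simp only [eval_mul, eval_phiPoly, sq]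

theorem polyPairing_phiPoly {v : ℝ → ℝ} (hv : MemLp v 2 muI) (k : ℕ) :
    polyPairing hv (phiPoly k) = legendreCoeff v k * polyIntegral (phiPoly k * phiPoly k) := by
  rw [polyIntegral_phiPoly_self, legendreCoeff, mul_right_comm,
    inv_mul_cancel₀ (integral_Phi_sq_pos k).ne', one_mul, polyPairing_apply]
  simp only [eval_phiPoly, mul_comm]

theorem polyIntegral_sum_phiPoly_mul (s : Finset ℕ) (c : ℕ → ℝ) {j : ℕ} (hj : j ∈ s) :
    polyIntegral ((∑ k ∈ s, C (c k) * phiPoly k) * phiPoly j) =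
      c j * polyIntegral (phiPoly j * phiPoly j) := by
  rw [Finset.sum_mul, map_sum, Finset.sum_eq_single_of_mem j hj]
  · rw [mul_assoc, polyIntegral_C_mul]
  · intro k _ hk
    rw [mul_assoc, polyIntegral_C_mul, polyIntegral_phiPoly_mul hk, mul_zero]

theorem polyIntegral_sum_mul_sum (s : Finset ℕ) (c d : ℕ → ℝ) :
    polyIntegral ((∑ k ∈ s, C (c k) * phiPoly k) * ∑ k ∈ s, C (d k) * phiPoly k) =
      ∑ k ∈ s, c k * d k * polyIntegral (phiPoly k * phiPoly k) := by
  rw [Finset.mul_sum, map_sum]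
  refine Finset.sum_congr rfl fun j hj => ?_
  rw [mul_left_comm, polyIntegral_C_mul, polyIntegral_sum_phiPoly_mul s c hj]
  ring

/-- By linearity it suffices to test on Φ_0, …, Φ_N. This is the orthogonality of the projection
error to polynomials of degree at most N. -/
theorem polyPairing_eq_of_natDegree_le {v : ℝ → ℝ} (hv : MemLp v 2 muI) {N : ℕ} {p : ℝ[X]}
    (hp : p.natDegree ≤ N) : polyPairing hv p = polyIntegral (projPoly N v * p) := by
  have h := mem_span_phiPoly hp
  clear hp
  induction h using Submodule.span_induction with
  | mem x hx =>
    obtain ⟨j, hj, rfl⟩ := hx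
    rw [projPoly, polyIntegral_sum_phiPoly_mul _ _
      (Finset.mem_range.2 (Nat.lt_succ_of_le (Set.mem_Iic.1 hj))), polyPairing_phiPoly]
  | zero => simp
  | add x y _ _ hx hy => rw [map_add, mul_add, map_add, hx, hy]
  | smul c x _ hx => rw [map_smul, mul_smul_comm, map_smul, hx]

/-- The squared `L²(I_ξ)` distance of a scalar function to a polynomial. -/
noncomputable def sqDist (v : ℝ → ℝ) (p : ℝ[X]) : ℝ := ∫ z in Ixi, (v z - p.eval z) ^ 2

theorem sqDist_nonneg (v : ℝ → ℝ) (p : ℝ[X]) : 0 ≤ sqDist v p :=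
  integral_nonneg fun _ => sq_nonneg _

theorem sqDist_eq {v : ℝ → ℝ} (hv : MemLp v 2 muI) (p : ℝ[X]) :
    sqDist v p = (∫ z in Ixi, v z ^ 2) - 2 * polyPairing hv p + polyIntegral (p * p) := by
  have h : ∀ z, (v z - p.eval z) ^ 2 = (v z ^ 2 - 2 * (v z * p.eval z)) + (p * p).eval z := by
    intro z; rw [eval_mul]; ring
  have h1 := (hv.integrable_fun_mul (memLp_eval p)).const_mul 2
  have h2 : Integrable (fun z => v z ^ 2 - 2 * (v z * p.eval z)) muI := hv.integrable_sq.sub h1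
  rw [sqDist]
  simp_rw [h]
  rw [integral_add h2 (integrable_eval _), integral_sub hv.integrable_sq h1,
    integral_const_mul]
  rfl

theorem sqDist_pythagoras {v : ℝ → ℝ} (hv : MemLp v 2 muI) {N : ℕ} {q : ℝ[X]}
    (hq : q.natDegree ≤ N) : sqDist v q = sqDist v (projPoly N v) +
      polyIntegral ((projPoly N v - q) * (projPoly N v - q)) := by
  rw [sqDist_eq hv, sqDist_eq hv, polyPairing_eq_of_natDegree_le hv hq,
    polyPairing_eq_of_natDegree_le hv (natDegree_projPoly_le N v)]
  have : (projPoly N v - q) * (projPoly N v - q) = projPoly N v * projPoly N v -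
    C 2 * (projPoly N v * q) + q * q := by
    rw [show (C 2 : ℝ[X]) = 2 from rfl]; ring
  rw [this, map_add, map_sub, polyIntegral_C_mul]
  ring

theorem polyIntegral_mul_self_nonneg (p : ℝ[X]) : 0 ≤ polyIntegral (p * p) := by
  rw [polyIntegral_apply]
  exact integral_nonneg fun z => by rw [eval_mul]; exact mul_self_nonneg _

theorem sqDist_projPoly_le {v : ℝ → ℝ} (hv : MemLp v 2 muI) {N : ℕ} {q : ℝ[X]}
    (hq : q.natDegree ≤ N) : sqDist v (projPoly N v) ≤ sqDist v q := by
  rw [sqDist_pythagoras hv hq]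
  linarith [polyIntegral_mul_self_nonneg (projPoly N v - q)]

theorem exists_sqDist_le {v : ℝ → ℝ} (hv : MemLp v 2 muI) {ε : ℝ} (hε : 0 < ε) :
    ∃ p : ℝ[X], sqDist v p ≤ ε := by
  have h3 := sqrt_three_pos
  obtain ⟨g, -, hg, hgc, hgm⟩ := MemLp.exists_hasCompactSupport_integral_rpow_sub_le (μ := muI)
    (p := 2) (by norm_num) (f := v) (by simpa using hv) (ε := ε / 4) (by positivity)
  have hgm : MemLp g 2 muI := by simpa using hgm
  -- The squared tolerance ε/(8√3) times the length 2√3 of the interval is ε/4, so each half of the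
  -- splitting v - p = (v - g) + (g - p) contributes at most ε/2 after doubling.
  obtain ⟨p, hp⟩ := exists_polynomial_near_of_continuousOn (-Real.sqrt 3) (Real.sqrt 3) g
    hgc.continuousOn (Real.sqrt (ε / (8 * Real.sqrt 3))) (by positivity)
  refine ⟨p, ?_⟩
  have h1 : sqDist g p ≤ ε / 4 := by
    have hb : ∀ z ∈ Ixi, (g z - p.eval z) ^ 2 ≤ ε / (8 * Real.sqrt 3) := by
      intro z hz
      have := (hp z hz).le
      rw [abs_sub_comm] at this
      calc _ = |g z - p.eval z| ^ 2 := (sq_abs _).symm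
        _ ≤ _ := by
          rw [← Real.sq_sqrt (show 0 ≤ ε / (8 * Real.sqrt 3) by positivity)]
          gcongr
    calc sqDist g p ≤ ∫ z in Ixi, ε / (8 * Real.sqrt 3) :=
          setIntegral_mono_on (hgm.integrable_sub_sq (memLp_eval p)) (integrable_const _)
            measurableSet_Ixi hb
      _ = ε / 4 := by
        rw [setIntegral_const, Measure.real, volume_Ixi, ENNReal.toReal_ofReal (by positivity),
          smul_eq_mul]
        field_simp
        norm_num
  have h2 : ∫ z in Ixi, (v z - g z) ^ 2 ≤ ε / 4 := by
    simpa using hg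
  calc sqDist v p ≤ ∫ z in Ixi, (2 * (v z - g z) ^ 2 + 2 * (g z - p.eval z) ^ 2) := by
        refine integral_mono (hv.integrable_sub_sq (memLp_eval p))
          (((hv.integrable_sub_sq hgm).const_mul 2).add
            ((hgm.integrable_sub_sq (memLp_eval p)).const_mul 2)) fun z => ?_
        simp only
        nlinarith [sq_nonneg (v z - g z - (g z - p.eval z))]
    _ = 2 * (∫ z in Ixi, (v z - g z) ^ 2) + 2 * sqDist g p := by
        rw [integral_add ((hv.integrable_sub_sq hgm).const_mul 2)
            ((hgm.integrable_sub_sq (memLp_eval p)).const_mul 2), integral_const_mul,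
          integral_const_mul, sqDist]
    _ ≤ ε := by linarith

/-- A bound on all truncated tails of the Legendre expansion bounds the projection error. -/
theorem sqDist_projPoly_le_of_forall {v : ℝ → ℝ} (hv : MemLp v 2 muI) {N : ℕ} {K : ℝ}
    (h : ∀ M, N ≤ M →
      polyIntegral ((projPoly M v - projPoly N v) * (projPoly M v - projPoly N v)) ≤ K) :
    sqDist v (projPoly N v) ≤ K := by
  refine le_of_forall_pos_le_add fun ε hε => ?_
  obtain ⟨p, hp⟩ := exists_sqDist_le hv hε
  -- At level M the projection beats p, so its squared error is at most ε; Pythagoras says that the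
  -- error at level N exceeds it by exactly the tail between N and M.
  set M := max N p.natDegree with hM
  have h1 := sqDist_pythagoras hv (N := M) (q := projPoly N v)
    ((natDegree_projPoly_le N v).trans (le_max_left _ _))
  have h2 := sqDist_projPoly_le hv (N := M) (q := p) (le_max_right _ _)
  have h3 := h M (le_max_left _ _)
  linarith

end ScalarProjection

/-! ### Jackson's inequality for one weak derivative -/

section Jackson

open Polynomial

/-- `g` is a derivative of `v` on `I_ξ` in the sense of integration by parts against polynomials
vanishing at both endpoints. -/
def IsPolyWeakDeriv (v g : ℝ → ℝ) : Prop :=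
  ∀ p : ℝ[X], p.eval (Real.sqrt 3) = 0 → p.eval (-Real.sqrt 3) = 0 →
    ∫ z in Ixi, v z * (derivative p).eval z = -∫ z in Ixi, g z * p.eval z

theorem exists_natDegree_le_derivative_eq (q : ℝ[X]) :
    ∃ Q : ℝ[X], Q.natDegree ≤ q.natDegree + 1 ∧ derivative Q = q := by
  refine ⟨∑ i ∈ Finset.range (q.natDegree + 1), monomial (i + 1) (q.coeff i / (i + 1)), ?_, ?_⟩
  · refine natDegree_sum_le_of_forall_le _ _ fun i hi => ?_
    exact (natDegree_monomial_le _).trans (by have := Finset.mem_range.1 hi; omega)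
  · rw [derivative_sum]
    conv_rhs => rw [q.as_sum_range]
    refine Finset.sum_congr rfl fun i _ => ?_
    rw [derivative_monomial]
    have : (i : ℝ) + 1 ≠ 0 := by positivity
    push_cast
    rw [div_mul_cancel₀ _ this]

/-- With p the tail and (wr')' = -p, one has ‖p‖² = ⟨v, p⟩ = ⟨g, wr'⟩. Moreover ‖wr'‖² ≤ 3∫wr'² =
3⟨p, r⟩ ≤ 3‖p‖²/(N+1)², since w ≤ 3 and k(k+1) ≥ (N+1)² on the tail. Cauchy–Schwarz concludes,
without any boundary condition on v. -/
theorem jackson_tail {v g : ℝ → ℝ} (hv : MemLp v 2 muI) (hg : MemLp g 2 muI)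
    (hvg : IsPolyWeakDeriv v g) {N M : ℕ} (hNM : N ≤ M) :
    polyIntegral ((projPoly M v - projPoly N v) * (projPoly M v - projPoly N v)) ≤
      3 / ((N : ℝ) + 1) ^ 2 * ∫ z in Ixi, g z ^ 2 := by
  set s := Finset.Ico (N + 1) (M + 1) with hs
  set c := legendreCoeff v with hc
  have hp : projPoly M v - projPoly N v = ∑ k ∈ s, C (c k) * phiPoly k := by
    rw [projPoly, projPoly, hs, Finset.sum_Ico_eq_sub _ (by omega)]
  rw [hp]
  set p : ℝ[X] := ∑ k ∈ s, C (c k) * phiPoly k with hpdef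
  -- Dividing by the eigenvalues inverts the Sturm–Liouville operator on the tail.
  set r : ℝ[X] := ∑ k ∈ s, C (c k / ((k : ℝ) * (k + 1))) * phiPoly k with hr
  set X := polyIntegral (p * p) with hX
  have hX0 : 0 ≤ X := polyIntegral_mul_self_nonneg p
  have hsk : ∀ k ∈ s, (N : ℝ) + 1 ≤ k := by
    intro k hk
    have := (Finset.mem_Ico.1 hk).1
    exact_mod_cast this
  have hode : derivative (weight * derivative r) = -p := by
    rw [hr, hpdef, derivative_sum, Finset.mul_sum, derivative_sum, ← Finset.sum_neg_distrib]
    refine Finset.sum_congr rfl fun k hk => ?_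
    have hk0 : (0 : ℝ) < k := by linarith [hsk k hk, (Nat.cast_nonneg N : (0 : ℝ) ≤ N)]
    rw [derivative_C_mul, mul_left_comm, derivative_C_mul, weight_phiPoly_ode, ← mul_assoc,
      ← C_mul, ← neg_mul (C (c k)), ← C_neg]
    congr 2
    field_simp
  have hX1 : polyPairing hv p = X := by
    rw [hX, hpdef, polyIntegral_sum_mul_sum, map_sum]
    refine Finset.sum_congr rfl fun k _ => ?_
    rw [← smul_eq_C_mul, map_smul, polyPairing_phiPoly, smul_eq_mul, hc]
    ring
  have hX2 : X = ∫ z in Ixi, g z * (weight * derivative r).eval z := by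
    have := hvg (weight * derivative r) (by rw [eval_mul, eval_weight_sqrt, zero_mul])
      (by rw [eval_mul, eval_weight_neg_sqrt, zero_mul])
    rw [hode] at this
    simp only [eval_neg, mul_neg, integral_neg, neg_inj] at this
    rw [← hX1, polyPairing_apply, this]
  have hE : ∫ z in Ixi, ((weight * derivative r).eval z) ^ 2 ≤
      3 * polyIntegral (weight * derivative r * derivative r) := by
    rw [polyIntegral_apply, ← integral_const_mul]
    refine setIntegral_mono_on (memLp_eval _).integrable_sq ((integrable_eval _).const_mul 3)
      measurableSet_Ixi fun z hz => ?_
    have h3 := sq_le_three hz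
    simp only [eval_mul, eval_weight]
    have : (3 - (3 - z ^ 2)) * ((3 - z ^ 2) * (derivative r).eval z ^ 2) ≥ 0 := by
      have : 0 ≤ 3 - z ^ 2 := by linarith
      have : 0 ≤ 3 - (3 - z ^ 2) := by nlinarith
      positivity
    nlinarith
  have hpr : polyIntegral (weight * derivative r * derivative r) ≤ X / ((N : ℝ) + 1) ^ 2 := by
    have h1 := polyIntegral_sturm r r
    rw [hode, neg_mul, map_neg, neg_inj] at h1
    rw [← h1, hX, hr, hpdef, polyIntegral_sum_mul_sum, polyIntegral_sum_mul_sum, Finset.sum_div]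
    refine Finset.sum_le_sum fun k hk => ?_
    have hk1 := hsk k hk
    have hN : (0 : ℝ) ≤ N := Nat.cast_nonneg N
    have h2 : 0 ≤ c k * c k * polyIntegral (phiPoly k * phiPoly k) :=
      mul_nonneg (mul_self_nonneg _) (polyIntegral_mul_self_nonneg _)
    calc _ = c k * c k * polyIntegral (phiPoly k * phiPoly k) / ((k : ℝ) * (k + 1)) := by ring
      _ ≤ _ := div_le_div_of_nonneg_left h2 (by positivity) (by nlinarith)
  have hcs := sq_integral_mul_le hg (memLp_eval (weight * derivative r))
  rw [← hX2] at hcs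
  have hG : 0 ≤ ∫ z in Ixi, g z ^ 2 := integral_nonneg fun z => sq_nonneg _
  have h4 : X ^ 2 ≤ (3 / ((N : ℝ) + 1) ^ 2 * ∫ z in Ixi, g z ^ 2) * X := by
    calc X ^ 2 ≤ _ := hcs
      _ ≤ (∫ z in Ixi, g z ^ 2) * (3 * (X / ((N : ℝ) + 1) ^ 2)) := by gcongr; linarith
      _ = _ := by ring
  rcases hX0.eq_or_lt with h0 | h0
  · rw [← h0]
    positivity
  · exact le_of_mul_le_mul_right (by linarith [sq X]) h0

theorem sqDist_projPoly_le_of_weakDeriv {v g : ℝ → ℝ} (hv : MemLp v 2 muI) (hg : MemLp g 2 muI)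
    (hvg : IsPolyWeakDeriv v g) (N : ℕ) :
    sqDist v (projPoly N v) ≤ 3 / ((N : ℝ) + 1) ^ 2 * ∫ z in Ixi, g z ^ 2 :=
  sqDist_projPoly_le_of_forall hv fun _ hM => jackson_tail hv hg hvg hM

theorem IsPolyWeakDeriv.sub_eval {v g : ℝ → ℝ} (hv : MemLp v 2 muI) (hg : MemLp g 2 muI)
    (hvg : IsPolyWeakDeriv v g) (Q : ℝ[X]) :
    IsPolyWeakDeriv (fun z => v z - Q.eval z) (fun z => g z - (derivative Q).eval z) := by
  intro p hp hp'
  simp only [sub_mul, ← eval_mul]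
  rw [integral_sub (hv.integrable_fun_mul (memLp_eval _)) (integrable_eval _),
    integral_sub (hg.integrable_fun_mul (memLp_eval _)) (integrable_eval _), hvg p hp hp',
    ← polyIntegral_apply, ← polyIntegral_apply]
  have h := polyIntegral_derivative (Q * p)
  rw [derivative_mul, map_add, eval_mul, eval_mul, hp, hp'] at h
  linarith

/-- Jackson's inequality with the derivative measured modulo polynomials. -/
theorem sqDist_projPoly_le_sqDist_deriv {v g : ℝ → ℝ} (hv : MemLp v 2 muI) (hg : MemLp g 2 muI)
    (hvg : IsPolyWeakDeriv v g) {N : ℕ} {q : ℝ[X]} (hq : q.natDegree + 1 ≤ N) :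
    sqDist v (projPoly N v) ≤ 3 / ((N : ℝ) + 1) ^ 2 * sqDist g q := by
  obtain ⟨Q, hQ, rfl⟩ := exists_natDegree_le_derivative_eq q
  set w : ℝ → ℝ := fun z => v z - Q.eval z with hw
  have hwm : MemLp w 2 muI := hv.sub (memLp_eval Q)
  -- Q has degree at most N, so Q plus the projection of v - Q is an admissible competitor.
  calc sqDist v (projPoly N v) ≤ sqDist v (Q + projPoly N w) :=
        sqDist_projPoly_le hv ((natDegree_add_le _ _).trans
          (max_le (hQ.trans hq) (natDegree_projPoly_le N w)))
    _ = sqDist w (projPoly N w) := by simp only [sqDist, hw, eval_add, sub_sub]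
    _ ≤ _ := sqDist_projPoly_le_of_weakDeriv hwm (hg.sub (memLp_eval _)) (hvg.sub_eval hv hg Q) N

end Jackson

/-! ### Kernel estimates with the Gagliardo seminorm -/

section FractionalSmoothing

/-- The squared Gagliardo seminorm of order `θ` of a scalar function on `I_ξ`. -/
noncomputable def gagliardo (θ : ℝ) (g : ℝ → ℝ) : ℝ≥0∞ :=
  ∫⁻ x in Ixi, ∫⁻ y in Ixi, ENNReal.ofReal (‖g x - g y‖ ^ 2 / |x - y| ^ (1 + 2 * θ))

/-- Cauchy–Schwarz on the ball of radius η around x: there ∫L² ≤ 2ηB², and |x - y| ≤ η lets the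
factor η^{1+2θ} pay for the Gagliardo denominator. -/
theorem ofReal_sq_integral_kernel_le {g : ℝ → ℝ} (hg : MemLp g 2 muI) {x η B θ : ℝ} (hη : 0 < η)
    (hθ : 0 < θ) {L : ℝ → ℝ} (hL : Continuous L) (hLB : ∀ y, |L y| ≤ B)
    (hL0 : ∀ y, η < |x - y| → L y = 0) :
    ENNReal.ofReal ((∫ y in Ixi, L y * (g y - g x)) ^ 2) ≤
      ENNReal.ofReal (B ^ 2 * (2 * η) * η ^ (1 + 2 * θ)) *
        ∫⁻ y in Ixi, ENNReal.ofReal (‖g x - g y‖ ^ 2 / |x - y| ^ (1 + 2 * θ)) := by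
  set S := Metric.closedBall x η with hS
  have hSm : MeasurableSet S := Metric.isClosed_closedBall.measurableSet
  set ν := volume.restrict (Ixi ∩ S) with hν
  have hνle : ν ≤ muI := Measure.restrict_mono_set _ inter_subset_left
  have hνfin : IsFiniteMeasure ν := isFiniteMeasure_of_le _ hνle
  have h1 : ∫ y in Ixi, L y * (g y - g x) = ∫ y, L y * (g y - g x) ∂ν := by
    refine setIntegral_eq_of_subset_of_forall_sdiff_eq_zero measurableSet_Ixi
      inter_subset_left fun y hy => ?_
    have : ¬ dist y x ≤ η := fun h => hy.2 ⟨hy.1, h⟩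
    rw [hL0 y (by rw [dist_comm, Real.dist_eq] at this; exact not_le.1 this), zero_mul]
  have hLm : MemLp L 2 ν :=
    MemLp.of_bound hL.aestronglyMeasurable B (Eventually.of_forall hLB)
  have hgm : MemLp (fun y => g y - g x) 2 ν := (hg.mono_measure hνle).sub (memLp_const _)
  have hcs := sq_integral_mul_le hLm hgm
  have hvol : ν.real univ ≤ 2 * η := by
    rw [hν, measureReal_restrict_apply_univ]
    calc volume.real (Ixi ∩ S) ≤ volume.real S :=
          measureReal_mono inter_subset_right
            (by rw [hS, Real.volume_closedBall]; exact ENNReal.ofReal_ne_top)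
      _ = 2 * η := by
        rw [hS, Measure.real, Real.volume_closedBall, ENNReal.toReal_ofReal (by positivity)]
  have hL2 : ∫ y, L y ^ 2 ∂ν ≤ B ^ 2 * (2 * η) := by
    calc ∫ y, L y ^ 2 ∂ν ≤ ∫ y, B ^ 2 ∂ν :=
          integral_mono hLm.integrable_sq (integrable_const _) fun y =>
            sq_le_sq' (neg_le_of_abs_le (hLB y)) (le_of_abs_le (hLB y))
      _ = B ^ 2 * ν.real univ := by rw [integral_const, smul_eq_mul, mul_comm]
      _ ≤ _ := by gcongr
  have hg2 : ENNReal.ofReal (∫ y, (g y - g x) ^ 2 ∂ν) ≤ ENNReal.ofReal (η ^ (1 + 2 * θ)) *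
      ∫⁻ y in Ixi, ENNReal.ofReal (‖g x - g y‖ ^ 2 / |x - y| ^ (1 + 2 * θ)) := by
    rw [ofReal_integral_eq_lintegral_ofReal hgm.integrable_sq
      (Eventually.of_forall fun y => sq_nonneg _)]
    calc ∫⁻ y, ENNReal.ofReal ((g y - g x) ^ 2) ∂ν
        ≤ ∫⁻ y, ENNReal.ofReal (η ^ (1 + 2 * θ)) *
            ENNReal.ofReal (‖g x - g y‖ ^ 2 / |x - y| ^ (1 + 2 * θ)) ∂ν := by
          refine setLIntegral_mono_ae' (measurableSet_Ixi.inter hSm)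
            (Eventually.of_forall fun y hy => ?_)
          rw [← ENNReal.ofReal_mul (by positivity)]
          refine ENNReal.ofReal_le_ofReal ?_
          rcases eq_or_ne x y with rfl | hxy
          · simp
          · have hd : 0 < |x - y| := abs_pos.2 (sub_ne_zero.2 hxy)
            have hle : |x - y| ≤ η := by
              have : dist y x ≤ η := hy.2
              rwa [dist_comm, Real.dist_eq] at this
            rw [Real.norm_eq_abs, sq_abs, mul_div_assoc', le_div_iff₀ (by positivity), sub_sq_comm,
              mul_comm]
            gcongr
      _ = ENNReal.ofReal (η ^ (1 + 2 * θ)) *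
          ∫⁻ y, ENNReal.ofReal (‖g x - g y‖ ^ 2 / |x - y| ^ (1 + 2 * θ)) ∂ν :=
        lintegral_const_mul' _ _ ENNReal.ofReal_ne_top
      _ ≤ _ := by gcongr
  rw [h1]
  calc ENNReal.ofReal ((∫ y, L y * (g y - g x) ∂ν) ^ 2)
      ≤ ENNReal.ofReal (B ^ 2 * (2 * η) * ∫ y, (g y - g x) ^ 2 ∂ν) := by
        refine ENNReal.ofReal_le_ofReal (hcs.trans ?_)
        have : 0 ≤ ∫ y, (g y - g x) ^ 2 ∂ν := integral_nonneg fun y => sq_nonneg _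
        gcongr
    _ = ENNReal.ofReal (B ^ 2 * (2 * η)) * ENNReal.ofReal (∫ y, (g y - g x) ^ 2 ∂ν) :=
        ENNReal.ofReal_mul (by positivity)
    _ ≤ ENNReal.ofReal (B ^ 2 * (2 * η)) * (ENNReal.ofReal (η ^ (1 + 2 * θ)) *
        ∫⁻ y in Ixi, ENNReal.ofReal (‖g x - g y‖ ^ 2 / |x - y| ^ (1 + 2 * θ))) := by gcongr
    _ = _ := by rw [← mul_assoc, ← ENNReal.ofReal_mul (by positivity)]

/-- Serves both the error of a mollification (kernel of integral one) and its derivative (kernel of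
integral zero): each has the form ∫ L(x,y)(g(y) - g(x)) dy. -/
theorem integral_sq_kernel_le {g : ℝ → ℝ} (hg : MemLp g 2 muI) {η B θ : ℝ} (hη : 0 < η)
    (hθ : 0 < θ) (hG : gagliardo θ g < ⊤) {L : ℝ → ℝ → ℝ} (hL : ∀ x, Continuous (L x))
    (hLB : ∀ x y, |L x y| ≤ B) (hL0 : ∀ x ∈ Ixi, ∀ y, η < |x - y| → L x y = 0) {F : ℝ → ℝ}
    (hF : MemLp F 2 muI) (hFL : ∀ x ∈ Ixi, F x = ∫ y in Ixi, L x y * (g y - g x)) :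
    ∫ x in Ixi, F x ^ 2 ≤ B ^ 2 * (2 * η) * η ^ (1 + 2 * θ) * (gagliardo θ g).toReal := by
  have hc : 0 ≤ B ^ 2 * (2 * η) * η ^ (1 + 2 * θ) := by positivity
  rw [integral_eq_lintegral_of_nonneg_ae (Eventually.of_forall fun x => sq_nonneg _)
    hF.integrable_sq.aestronglyMeasurable]
  refine ENNReal.toReal_le_of_le_ofReal (by positivity) ?_
  rw [ENNReal.ofReal_mul hc, ENNReal.ofReal_toReal hG.ne, gagliardo,
    ← lintegral_const_mul' _ _ ENNReal.ofReal_ne_top]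
  refine setLIntegral_mono_ae' measurableSet_Ixi (Eventually.of_forall fun x hx => ?_)
  rw [hFL x hx]
  exact ofReal_sq_integral_kernel_le hg hη hθ (hL x) (hLB x) (hL0 x hx)

theorem exists_smooth_bump : ∃ (φ φ' : ℝ → ℝ) (A : ℝ), (∀ t, HasDerivAt φ (φ' t) t) ∧
    Continuous φ' ∧ (∀ t, |φ t| ≤ A) ∧ (∀ t, |φ' t| ≤ A) ∧ (∀ t, 1 ≤ |t| → φ t = 0) ∧
    (∀ t, 1 ≤ |t| → φ' t = 0) ∧ ∫ t, φ t = 1 := by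
  let b : ContDiffBump (0 : ℝ) := ⟨1 / 4, 1 / 2, by norm_num, by norm_num⟩
  set φ := b.normed volume with hφ
  have hd : ContDiff ℝ 1 φ := b.contDiff_normed
  have hs : HasCompactSupport φ := b.hasCompactSupport_normed
  have hd' : Continuous (deriv φ) := hd.continuous_deriv le_rfl
  obtain ⟨A₁, hA₁⟩ := hd.continuous.bounded_above_of_compact_support hs
  obtain ⟨A₂, hA₂⟩ := hd'.bounded_above_of_compact_support hs.deriv
  have h0 : ∀ t, 1 ≤ |t| → t ∉ tsupport φ := by
    intro t ht h
    rw [hφ, b.tsupport_normed_eq, Metric.mem_closedBall, Real.dist_eq, sub_zero] at h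
    change |t| ≤ 1 / 2 at h
    linarith
  refine ⟨φ, deriv φ, max A₁ A₂, fun t => (hd.differentiable one_ne_zero t).hasDerivAt, hd',
    fun t => (hA₁ t).trans (le_max_left _ _), fun t => (hA₂ t).trans (le_max_right _ _),
    fun t ht => image_eq_zero_of_notMem_tsupport (h0 t ht), fun t ht => ?_, b.integral_normed⟩
  exact image_eq_zero_of_notMem_tsupport fun h => h0 t ht (tsupport_deriv_subset h)

end FractionalSmoothing

/-! ### Mollification on the interval and Jackson's inequality of fractional order -/

section FractionalJackson

open Polynomial

theorem isPolyWeakDeriv_of_hasDerivAt {w D : ℝ → ℝ} (hd : ∀ x, HasDerivAt w (D x) x)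
    (hD : Continuous D) : IsPolyWeakDeriv w D := by
  intro p hp hp'
  rw [setIntegral_Ixi, setIntegral_Ixi, intervalIntegral.integral_mul_deriv_eq_deriv_mul
    (fun x _ => hd x) (fun x _ => p.hasDerivAt x) (hD.intervalIntegrable _ _)
    ((derivative p).continuous.intervalIntegrable _ _), hp, hp']
  ring

/-- Average g against a bump of width ρ. The kernel has size 1/ρ and its x-derivative size 1/ρ²,
which accounts for the extra ρ^{-2} in the derivative estimate. -/
theorem exists_smoothing {g : ℝ → ℝ} (hg : MemLp g 2 muI) {θ : ℝ} (hθ : 0 < θ)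
    (hG : gagliardo θ g < ⊤) : ∃ C : ℝ, 0 ≤ C ∧ ∀ ρ, 0 < ρ → ρ < Real.sqrt 3 →
      ∃ w D : ℝ → ℝ, MemLp w 2 muI ∧ MemLp D 2 muI ∧ IsPolyWeakDeriv w D ∧
        ∫ x in Ixi, (g x - w x) ^ 2 ≤ C * ρ ^ (2 * θ) ∧
        ∫ x in Ixi, D x ^ 2 ≤ C * (ρ ^ (2 * θ) / ρ ^ 2) := by
  obtain ⟨φ, φ', A, hφ, hφ'c, hφA, hφ'A, hφ0, hφ'0, hφi⟩ := exists_smooth_bump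
  have hφc : Continuous φ := continuous_iff_continuousAt.2 fun t => (hφ t).continuousAt
  have hA : 0 ≤ A := (abs_nonneg _).trans (hφA 0)
  have h3 := sqrt_three_pos
  set G := (gagliardo θ g).toReal with hGr
  have hG0 : 0 ≤ G := ENNReal.toReal_nonneg
  have hgi : Integrable g muI := hg.integrable one_le_two
  refine ⟨A ^ 2 * (2 * 2) * 2 ^ (1 + 2 * θ) * G, by positivity, fun ρ hρ hρ3 => ?_⟩
  -- The bump for x is centred at lx instead of x, so that its window of radius ρ stays inside the
  -- interval and g need not be extended. As |x - lx| ≤ ρ, the window lies within 2ρ of x.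
  set l : ℝ := 1 - ρ / Real.sqrt 3 with hl
  have hl0 : 0 < l := by
    have : ρ / Real.sqrt 3 < 1 := (div_lt_one h3).2 hρ3
    linarith
  have hl1 : l ≤ 1 := by
    have : 0 < ρ / Real.sqrt 3 := by positivity
    linarith
  have hl3 : l * Real.sqrt 3 = Real.sqrt 3 - ρ := by
    rw [hl]; field_simp
  have habs : ∀ x ∈ Ixi, |x| ≤ Real.sqrt 3 := fun x hx => abs_le.2 hx
  have hout : ∀ x ∈ Ixi, ∀ y, y ∉ Ixi → 1 ≤ |(y - l * x) / ρ| := by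
    intro x hx y hy
    rw [abs_div, abs_of_pos hρ, one_le_div hρ]
    have h1 : Real.sqrt 3 ≤ |y| := by
      by_contra hlt
      exact hy (abs_le.1 (not_le.1 hlt).le)
    have h2 : |l * x| ≤ Real.sqrt 3 - ρ := by
      rw [abs_mul, abs_of_pos hl0, ← hl3]
      exact mul_le_mul_of_nonneg_left (habs x hx) hl0.le
    linarith [abs_sub_abs_le_abs_sub y (l * x)]
  have hfar : ∀ x ∈ Ixi, ∀ y, 2 * ρ < |x - y| → 1 ≤ |(y - l * x) / ρ| := by
    intro x hx y hy
    rw [abs_div, abs_of_pos hρ, one_le_div hρ]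
    have h2 : |x - l * x| ≤ ρ := by
      have : x - l * x = ρ / Real.sqrt 3 * x := by rw [hl]; ring
      rw [this, abs_mul, abs_of_pos (by positivity)]
      calc ρ / Real.sqrt 3 * |x| ≤ ρ / Real.sqrt 3 * Real.sqrt 3 := by
            gcongr; exact habs x hx
        _ = ρ := div_mul_cancel₀ _ h3.ne'
    have h4 : |x - y| ≤ |x - l * x| + |y - l * x| := by
      rw [abs_sub_comm y]
      exact abs_sub_le _ _ _
    linarith
  set K : ℝ → ℝ → ℝ := fun x y => ρ⁻¹ * φ ((y - l * x) / ρ) with hK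
  set K' : ℝ → ℝ → ℝ := fun x y => ρ⁻¹ * (φ' ((y - l * x) / ρ) * (-l / ρ)) with hK'
  have hKc : ∀ x, Continuous (K x) := fun x => by simp only [hK]; fun_prop
  have hK'c : ∀ x, Continuous (K' x) := fun x => by simp only [hK']; fun_prop
  have hKA : ∀ x y, |K x y| ≤ A / ρ := by
    intro x y
    simp only [hK]
    rw [abs_mul, abs_of_pos (inv_pos.2 hρ), inv_mul_eq_div]
    gcongr
    exact hφA _
  have hK'A : ∀ x y, |K' x y| ≤ A / ρ ^ 2 := by
    intro x y
    simp only [hK']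
    rw [abs_mul, abs_mul, abs_of_pos (inv_pos.2 hρ), abs_div, abs_neg, abs_of_pos hl0,
      abs_of_pos hρ]
    calc ρ⁻¹ * (|φ' ((y - l * x) / ρ)| * (l / ρ)) ≤ ρ⁻¹ * (A * (1 / ρ)) := by
          gcongr
          exact hφ'A _
      _ = A / ρ ^ 2 := by field_simp
  have hKd : ∀ x y, HasDerivAt (fun x => K x y) (K' x y) x := by
    intro x y
    have h1 : HasDerivAt (fun x => (y - l * x) / ρ) (-l / ρ) x := by
      have := (((hasDerivAt_id x).const_mul l).const_sub y).div_const ρ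
      simpa using this
    exact ((hφ _).comp x h1).const_mul _
  have hKint : ∀ x ∈ Ixi, ∫ y in Ixi, K x y = 1 := by
    intro x hx
    rw [setIntegral_eq_integral_of_forall_compl_eq_zero (fun y hy => by
      simp only [hK]; rw [hφ0 _ (hout x hx y hy), mul_zero])]
    simp only [hK]
    rw [integral_const_mul, integral_sub_right_eq_self (fun y => φ (y / ρ)) (l * x),
      Measure.integral_comp_div, hφi, abs_of_pos hρ, smul_eq_mul, mul_one, inv_mul_cancel₀ hρ.ne']
  have hK'int : ∀ x ∈ Ixi, ∫ y in Ixi, K' x y = 0 := by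
    intro x hx
    -- The kernel depends on y - lx only, so ∂ₓK = -l ∂_yK, and K vanishes at both endpoints.
    have hprim : ∀ y, HasDerivAt (fun y => -l * K x y) (K' x y) y := by
      intro y
      have h1 : HasDerivAt (fun y => (y - l * x) / ρ) (1 / ρ) y :=
        ((hasDerivAt_id y).sub_const _).div_const ρ
      have h2 := (((hφ _).comp y h1).const_mul ρ⁻¹).const_mul (-l)
      refine h2.congr_deriv ?_
      simp only [hK']
      ring
    have hxl : |l * x| ≤ Real.sqrt 3 - ρ := by
      rw [abs_mul, abs_of_pos hl0, ← hl3]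
      exact mul_le_mul_of_nonneg_left (habs x hx) hl0.le
    have e1 : K x (Real.sqrt 3) = 0 := by
      simp only [hK]
      rw [hφ0, mul_zero]
      rw [abs_div, abs_of_pos hρ, one_le_div hρ]
      exact le_trans (by linarith [(abs_le.1 hxl).2]) (le_abs_self _)
    have e2 : K x (-Real.sqrt 3) = 0 := by
      simp only [hK]
      rw [hφ0, mul_zero]
      rw [abs_div, abs_of_pos hρ, one_le_div hρ]
      exact le_trans (by linarith [(abs_le.1 hxl).1]) (neg_le_abs _)
    rw [setIntegral_Ixi, intervalIntegral.integral_eq_sub_of_hasDerivAt (fun y _ => hprim y)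
      ((hK'c x).intervalIntegrable _ _), e1, e2, sub_self]
  set w : ℝ → ℝ := fun x => ∫ y in Ixi, K x y * g y with hw
  set D : ℝ → ℝ := fun x => ∫ y in Ixi, K' x y * g y with hD
  have hKi : ∀ {c : ℝ} {k : ℝ → ℝ}, Continuous k → (∀ y, |k y| ≤ c) →
      Integrable (fun y => k y * g y) muI := fun hk hc =>
    hgi.bdd_mul hk.aestronglyMeasurable (Eventually.of_forall hc)
  have hwD : ∀ x, HasDerivAt w (D x) x := by
    intro x
    refine (hasDerivAt_integral_of_dominated_loc_of_deriv_le (μ := muI) (s := univ)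
      (F := fun x y => K x y * g y) (F' := fun x y => K' x y * g y)
      (bound := fun y => A / ρ ^ 2 * |g y|) univ_mem
      (Eventually.of_forall fun x => (hKi (hKc x) (hKA x)).aestronglyMeasurable)
      (hKi (hKc x) (hKA x)) (hKi (hK'c x) (hK'A x)).aestronglyMeasurable
      (Eventually.of_forall fun y x _ => ?_) (hgi.abs.const_mul _)
      (Eventually.of_forall fun y x _ => (hKd x y).mul_const _)).2
    rw [Real.norm_eq_abs, abs_mul]
    exact mul_le_mul_of_nonneg_right (hK'A x y) (abs_nonneg _)
  have hDc : Continuous D := by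
    refine continuous_of_dominated (bound := fun y => A / ρ ^ 2 * |g y|)
      (fun x => (hKi (hK'c x) (hK'A x)).aestronglyMeasurable)
      (fun x => Eventually.of_forall fun y => ?_) (hgi.abs.const_mul _)
      (Eventually.of_forall fun y => ?_)
    · rw [Real.norm_eq_abs, abs_mul]
      exact mul_le_mul_of_nonneg_right (hK'A x y) (abs_nonneg _)
    · simp only [hK']
      fun_prop
  have hwc : Continuous w := continuous_iff_continuousAt.2 fun t => (hwD t).continuousAt
  have hwm : MemLp w 2 muI := hwc.continuousOn.memLp_Ixi 2
  have hDm : MemLp D 2 muI := hDc.continuousOn.memLp_Ixi 2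
  have hpow : (2 * ρ) ^ (1 + 2 * θ) = 2 ^ (1 + 2 * θ) * (ρ * ρ ^ (2 * θ)) := by
    rw [Real.mul_rpow zero_le_two hρ.le, Real.rpow_add hρ, Real.rpow_one]
  refine ⟨w, D, hwm, hDm, isPolyWeakDeriv_of_hasDerivAt hwD hDc, ?_, ?_⟩
  · have h := integral_sq_kernel_le hg (η := 2 * ρ) (by positivity) hθ hG hKc hKA
      (fun x hx y hy => by simp only [hK]; rw [hφ0 _ (hfar x hx y hy), mul_zero])
      (F := fun x => w x - g x) (hwm.sub hg) (fun x hx => by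
        simp only [mul_sub]
        rw [integral_sub (hKi (hKc x) (hKA x)) ((hKc x).continuousOn.integrable_Ixi.mul_const _),
          integral_mul_const, hKint x hx, one_mul])
    simp only [sub_sq_comm (g _)]
    refine h.trans (le_of_eq ?_)
    rw [hpow, ← hGr]
    field_simp
  · have h := integral_sq_kernel_le hg (η := 2 * ρ) (by positivity) hθ hG hK'c hK'A
      (fun x hx y hy => by simp only [hK']; rw [hφ'0 _ (hfar x hx y hy), zero_mul, mul_zero])
      hDm (fun x hx => by
        simp only [mul_sub]
        rw [integral_sub (hKi (hK'c x) (hK'A x)) ((hK'c x).continuousOn.integrable_Ixi.mul_const _),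
          integral_mul_const, hK'int x hx, zero_mul, sub_zero])
    refine h.trans (le_of_eq ?_)
    rw [hpow, ← hGr]
    field_simp

/-- Jackson's inequality of fractional order. -/
theorem exists_sqDist_projPoly_le_of_gagliardo {g : ℝ → ℝ} (hg : MemLp g 2 muI) {θ : ℝ}
    (hθ : 0 < θ) (hG : gagliardo θ g < ⊤) :
    ∃ C : ℝ, 0 ≤ C ∧ ∀ N : ℕ, sqDist g (projPoly N g) ≤ C * ((N : ℝ) + 1) ^ (-(2 * θ)) := by
  obtain ⟨C, hC, h⟩ := exists_smoothing hg hθ hG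
  -- Mollify at scale ρ = 1/(N+1) and project w. The error of w contributes 2C, and Jackson for w
  -- contributes 2 · 3C because its factor (N+1)^{-2} cancels ρ^{-2}.
  refine ⟨8 * C, by positivity, fun N => ?_⟩
  have hN : (0 : ℝ) < (N : ℝ) + 1 := by positivity
  have h3 : 1 < Real.sqrt 3 := by
    rw [Real.lt_sqrt zero_le_one]; norm_num
  obtain ⟨w, D, hw, hD, hwD, h1, h2⟩ := h ((N : ℝ) + 1)⁻¹ (by positivity)
    ((inv_le_one_of_one_le₀ (by linarith [(Nat.cast_nonneg N : (0 : ℝ) ≤ N)])).trans_lt h3)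
  have hpow : (((N : ℝ) + 1)⁻¹) ^ (2 * θ) = ((N : ℝ) + 1) ^ (-(2 * θ)) := by
    rw [Real.inv_rpow hN.le, Real.rpow_neg hN.le]
  rw [hpow] at h1 h2
  have hJ := sqDist_projPoly_le_of_weakDeriv hw hD hwD N
  set q := projPoly N w with hq
  have hJ' : sqDist w q ≤ 3 * C * ((N : ℝ) + 1) ^ (-(2 * θ)) := by
    calc sqDist w q ≤ 3 / ((N : ℝ) + 1) ^ 2 *
          (C * (((N : ℝ) + 1) ^ (-(2 * θ)) / (((N : ℝ) + 1)⁻¹) ^ 2)) :=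
          hJ.trans (by gcongr)
      _ = _ := by field_simp
  calc sqDist g (projPoly N g) ≤ sqDist g q := sqDist_projPoly_le hg (natDegree_projPoly_le N w)
    _ ≤ ∫ z in Ixi, (2 * (g z - w z) ^ 2 + 2 * (w z - q.eval z) ^ 2) := by
        refine integral_mono (hg.integrable_sub_sq (memLp_eval q))
          (((hg.integrable_sub_sq hw).const_mul 2).add
            ((hw.integrable_sub_sq (memLp_eval q)).const_mul 2)) fun z => ?_
        simp only
        nlinarith [sq_nonneg (g z - w z - (w z - q.eval z))]
    _ = 2 * (∫ z in Ixi, (g z - w z) ^ 2) + 2 * sqDist w q := by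
        rw [integral_add ((hg.integrable_sub_sq hw).const_mul 2)
            ((hw.integrable_sub_sq (memLp_eval q)).const_mul 2), integral_const_mul,
          integral_const_mul, sqDist]
    _ ≤ _ := by linarith

end FractionalJackson

/-! ### Weak derivatives, primitives and the lemma of du Bois-Reymond -/

section WeakDerivatives

open Polynomial

/-- The primitive of `g` vanishing at the left endpoint of `I_ξ`. -/
noncomputable def primitive (g : ℝ → ℝ) (z : ℝ) : ℝ := ∫ t in (-Real.sqrt 3)..z, g t

theorem uIcc_sqrt_three : uIcc (-Real.sqrt 3) (Real.sqrt 3) = Ixi :=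
  uIcc_of_le neg_sqrt_three_le

theorem _root_.MeasureTheory.Integrable.intervalIntegrable_Ixi {g : ℝ → ℝ}
    (hg : Integrable g muI) : IntervalIntegrable g volume (-Real.sqrt 3) (Real.sqrt 3) :=
  (intervalIntegrable_iff_integrableOn_Icc_of_le neg_sqrt_three_le).2 hg

theorem continuousOn_primitive {g : ℝ → ℝ} (hg : Integrable g muI) :
    ContinuousOn (primitive g) Ixi := by
  rw [← uIcc_sqrt_three]
  exact (hg.intervalIntegrable_Ixi.absolutelyContinuousOnInterval_intervalIntegral
    left_mem_uIcc).continuousOn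

theorem integral_primitive_mul_deriv {g p : ℝ → ℝ} (hg : Integrable g muI) (hp : ContDiff ℝ 1 p) :
    ∫ z in Ixi, primitive g z * deriv p z =
      primitive g (Real.sqrt 3) * p (Real.sqrt 3) - ∫ z in Ixi, g z * p z := by
  have hgi := hg.intervalIntegrable_Ixi
  have h := (hgi.absolutelyContinuousOnInterval_intervalIntegral
    left_mem_uIcc).integral_mul_deriv_eq_deriv_mul hp.contDiffOn.absolutelyContinuousOnInterval
  rw [setIntegral_Ixi, setIntegral_Ixi]
  simp only [primitive]
  rw [h, intervalIntegral.integral_same, zero_mul, sub_zero]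
  congr 1
  refine intervalIntegral.integral_congr_ae ?_
  filter_upwards [hgi.ae_hasDerivAt_integral] with z hz hz'
  rw [(hz (uIoc_subset_uIcc hz') _ left_mem_uIcc).deriv]

/-- Passes from compactly supported test functions to polynomials vanishing at the endpoints:
primitives are absolutely continuous, and the constant drops out because ∫p' = 0. -/
theorem isPolyWeakDeriv_of_ae_eq_primitive {v g : ℝ → ℝ} {c : ℝ} (hg : Integrable g muI)
    (h : ∀ᵐ z ∂muI, v z = c + primitive g z) : IsPolyWeakDeriv v g := by
  intro p hp hp'
  have hpc : ContDiff ℝ 1 fun z => p.eval z := by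
    simpa [coe_aeval_eq_eval] using p.contDiff_aeval (𝕜 := ℝ) 1
  have h1 := integral_primitive_mul_deriv hg hpc
  simp only [Polynomial.deriv, hp, mul_zero, zero_sub] at h1
  have h2 : Integrable (fun z => primitive g z * (derivative p).eval z) muI :=
    ((continuousOn_primitive hg).mul (derivative p).continuous.continuousOn).integrable_Ixi
  rw [← h1, integral_congr_ae (h.mono fun z hz => by rw [hz, add_mul]),
    integral_add ((integrable_eval _).const_mul c) h2, integral_const_mul, ← polyIntegral_apply,
    polyIntegral_derivative, hp, hp', sub_zero, mul_zero, zero_add]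

/-- Smooth functions with compact support in the interior of `I_ξ`. -/
structure IsTestFunction (φ : ℝ → ℝ) : Prop where
  contDiff : ContDiff ℝ ∞ φ
  hasCompactSupport : HasCompactSupport φ
  tsupport_subset : tsupport φ ⊆ interior Ixi

theorem IsTestFunction.continuous {φ : ℝ → ℝ} (h : IsTestFunction φ) : Continuous φ :=
  h.contDiff.continuous

theorem IsTestFunction.integrable_mul {φ f : ℝ → ℝ} (h : IsTestFunction φ)
    (hf : Integrable f muI) : Integrable (fun z => φ z * f z) muI := by
  obtain ⟨C, hC⟩ := h.continuous.bounded_above_of_compact_support h.hasCompactSupport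
  exact hf.bdd_mul h.continuous.aestronglyMeasurable (Eventually.of_forall hC)

theorem IsTestFunction.deriv {φ : ℝ → ℝ} (h : IsTestFunction φ) : IsTestFunction (deriv φ) :=
  ⟨(contDiff_infty_iff_deriv.1 h.contDiff).2, h.hasCompactSupport.deriv,
    (tsupport_deriv_subset).trans h.tsupport_subset⟩

theorem IsTestFunction.setIntegral_eq {φ : ℝ → ℝ} (h : IsTestFunction φ) (f : ℝ → ℝ) :
    ∫ z in Ixi, φ z * f z = ∫ z, φ z * f z :=
  setIntegral_eq_integral_of_forall_compl_eq_zero fun z hz => by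
    rw [image_eq_zero_of_notMem_tsupport fun h' => hz (interior_subset (h.tsupport_subset h')),
      zero_mul]

theorem exists_isTestFunction_integral_eq_one :
    ∃ η : ℝ → ℝ, IsTestFunction η ∧ ∫ z in Ixi, η z = 1 := by
  let b : ContDiffBump (0 : ℝ) := ⟨1 / 2, 1, by norm_num, by norm_num⟩
  have h3 : 1 < Real.sqrt 3 := by
    rw [Real.lt_sqrt zero_le_one]; norm_num
  have hb : IsTestFunction (b.normed volume) := by
    refine ⟨b.contDiff_normed, b.hasCompactSupport_normed, ?_⟩
    rw [b.tsupport_normed_eq, Real.closedBall_eq_Icc, Ixi, interior_Icc]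
    change Icc (0 - 1 : ℝ) (0 + 1) ⊆ _
    intro x hx
    exact ⟨by linarith [hx.1], by linarith [hx.2]⟩
  refine ⟨_, hb, ?_⟩
  have := hb.setIntegral_eq (fun _ => 1)
  simp only [mul_one] at this
  rw [this, b.integral_normed]

/-- The primitive from the left endpoint vanishes to the left of the support of χ, and also to its
right since the total integral is zero. -/
theorem IsTestFunction.exists_primitive {χ : ℝ → ℝ} (h : IsTestFunction χ)
    (h0 : ∫ z in Ixi, χ z = 0) : ∃ φ, IsTestFunction φ ∧ ∀ z, HasDerivAt φ (χ z) z := by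
  have h3 := sqrt_three_pos
  obtain ⟨a, b, ha, hb, hK⟩ : ∃ a b, -Real.sqrt 3 < a ∧ b < Real.sqrt 3 ∧
      tsupport χ ⊆ Icc a b := by
    rcases (tsupport χ).eq_empty_or_nonempty with he | hne
    · exact ⟨0, 0, by linarith, by linarith, by rw [he]; exact empty_subset _⟩
    · obtain ⟨a, ha⟩ := h.hasCompactSupport.isCompact.exists_isLeast hne
      obtain ⟨b, hb⟩ := h.hasCompactSupport.isCompact.exists_isGreatest hne
      have ha' := h.tsupport_subset ha.1
      have hb' := h.tsupport_subset hb.1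
      rw [Ixi, interior_Icc] at ha' hb'
      exact ⟨a, b, ha'.1, hb'.2, fun x hx => ⟨ha.2 hx, hb.2 hx⟩⟩
  have hz : ∀ t, t ∉ Icc a b → χ t = 0 := fun t ht =>
    image_eq_zero_of_notMem_tsupport fun h' => ht (hK h')
  have hint : ∀ x y, IntervalIntegrable χ volume x y := fun x y =>
    h.continuous.intervalIntegrable x y
  have hd : ∀ z, HasDerivAt (primitive χ) (χ z) z := fun z =>
    intervalIntegral.integral_hasDerivAt_right (hint _ _)
      (h.continuous.stronglyMeasurableAtFilter _ _) h.continuous.continuousAt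
  have hout : ∀ z, z ∉ Icc a b → primitive χ z = 0 := by
    intro z hzab
    rcases lt_or_ge z a with hza | hza
    · refine intervalIntegral.integral_zero_ae (Eventually.of_forall fun t ht => hz t fun h' => ?_)
      have := (uIoc_subset_uIcc ht).2
      have : t < a := lt_of_le_of_lt this (max_lt ha hza)
      linarith [h'.1]
    · have hzb : b < z := by
        by_contra hle
        exact hzab ⟨hza, not_lt.1 hle⟩
      rw [primitive, ← intervalIntegral.integral_add_adjacent_intervals (hint _ (Real.sqrt 3))
        (hint _ _), ← setIntegral_Ixi, h0, zero_add]
      refine intervalIntegral.integral_zero_ae (Eventually.of_forall fun t ht => hz t fun h' => ?_)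
      have := (uIoc_subset_uIcc ht).1
      have : b < t := lt_of_lt_of_le (lt_min hb hzb) this
      linarith [h'.2]
  have hts : tsupport (primitive χ) ⊆ Icc a b :=
    closure_minimal (fun z hz' => by_contra fun h' => hz' (hout z h')) isClosed_Icc
  refine ⟨primitive χ, ⟨?_, ?_, ?_⟩, hd⟩
  · rw [contDiff_infty_iff_deriv]
    refine ⟨fun z => (hd z).differentiableAt, ?_⟩
    rw [show _root_.deriv (primitive χ) = χ from funext fun z => (hd z).deriv]
    exact h.contDiff
  · exact HasCompactSupport.of_support_subset_isCompact isCompact_Icc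
      ((subset_tsupport _).trans hts)
  · rw [Ixi, interior_Icc]
    exact hts.trans fun x hx => ⟨lt_of_lt_of_le ha hx.1, lt_of_le_of_lt hx.2 hb⟩

/-- The lemma of du Bois-Reymond on `I_ξ`. -/
theorem ae_eq_primitive_of_weakDeriv {v g : ℝ → ℝ} (hv : Integrable v muI)
    (hg : Integrable g muI) (h : ∀ φ, IsTestFunction φ →
      ∫ z in Ixi, deriv φ z * v z = -∫ z in Ixi, φ z * g z) :
    ∃ c : ℝ, ∀ᵐ z ∂muI, v z = c + primitive g z := by
  set w : ℝ → ℝ := fun z => v z - primitive g z with hw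
  have hWi : Integrable (primitive g) muI := (continuousOn_primitive hg).integrable_Ixi
  have hwi : Integrable w muI := hv.sub hWi
  have hw0 : ∀ φ, IsTestFunction φ → ∫ z in Ixi, deriv φ z * w z = 0 := by
    intro φ hφ
    have h1 := integral_primitive_mul_deriv hg (hφ.contDiff.of_le (by exact_mod_cast le_top))
    have hend : φ (Real.sqrt 3) = 0 := by
      refine image_eq_zero_of_notMem_tsupport fun h' => ?_
      have := hφ.tsupport_subset h'
      rw [Ixi, interior_Icc] at this
      exact lt_irrefl _ this.2
    rw [hend, mul_zero, zero_sub] at h1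
    simp only [hw, mul_sub]
    rw [integral_sub (hφ.deriv.integrable_mul hv) (hφ.deriv.integrable_mul hWi), h φ hφ]
    simp only [mul_comm (deriv φ _), h1, mul_comm (φ _)]
    ring
  obtain ⟨η, hη, hη1⟩ := exists_isTestFunction_integral_eq_one
  set c := ∫ z in Ixi, η z * w z with hc
  refine ⟨c, ?_⟩
  have hloc : LocallyIntegrableOn (fun z => w z - c) (interior Ixi) volume := by
    refine IntegrableOn.locallyIntegrableOn ?_
    exact IntegrableOn.mono_set (hwi.sub (integrable_const c)) interior_subset
  have key : ∀ ψ : ℝ → ℝ, ContDiff ℝ ∞ ψ → HasCompactSupport ψ → tsupport ψ ⊆ interior Ixi →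
      ∫ z, ψ z • (w z - c) = 0 := by
    intro ψ h1 h2 h4
    have hψ : IsTestFunction ψ := ⟨h1, h2, h4⟩
    have hψi : Integrable ψ muI := hψ.continuous.continuousOn.integrable_Ixi
    have hηi : Integrable η muI := hη.continuous.continuousOn.integrable_Ixi
    set m := ∫ z in Ixi, ψ z with hm
    -- Removing the mean m of ψ makes it the derivative of a test function, against which w
    -- integrates to zero; hence ∫ψw = m∫ηw = mc.
    have hχ : IsTestFunction (fun z => ψ z - m * η z) := by
      have hs : tsupport (fun z => ψ z - m * η z) ⊆ tsupport ψ ∪ tsupport η := by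
        refine closure_minimal (fun z hz => ?_) ((isClosed_tsupport _).union (isClosed_tsupport _))
        by_contra h'
        rw [mem_union, not_or] at h'
        exact hz (by simp only; rw [image_eq_zero_of_notMem_tsupport h'.1,
          image_eq_zero_of_notMem_tsupport h'.2]; simp)
      exact ⟨hψ.contDiff.sub (contDiff_const.mul hη.contDiff),
        (hψ.hasCompactSupport.isCompact.union hη.hasCompactSupport.isCompact).of_isClosed_subset
          (isClosed_tsupport _) hs,
        hs.trans (union_subset hψ.tsupport_subset hη.tsupport_subset)⟩
    have hχ0 : ∫ z in Ixi, (ψ z - m * η z) = 0 := by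
      rw [integral_sub hψi (hηi.const_mul m), integral_const_mul, hη1]
      simp [hm]
    obtain ⟨φ, hφ, hφd⟩ := hχ.exists_primitive hχ0
    have h5 := hw0 φ hφ
    simp only [(hφd _).deriv, sub_mul, mul_assoc] at h5
    rw [integral_sub (hψ.integrable_mul hwi) ((hη.integrable_mul hwi).const_mul m),
      integral_const_mul, ← hc] at h5
    simp only [smul_eq_mul]
    rw [← hψ.setIntegral_eq]
    simp only [mul_sub]
    rw [integral_sub (hψ.integrable_mul hwi) (hψi.mul_const c), integral_mul_const]
    exact h5
  have h6 := isOpen_interior.ae_eq_zero_of_integral_contDiff_smul_eq_zero hloc key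
  have h7 : muI = volume.restrict (interior Ixi) := by
    rw [Ixi, interior_Icc]
    exact (Measure.restrict_congr_set Ioo_ae_eq_Icc).symm
  rw [h7, ae_restrict_iff' isOpen_interior.measurableSet]
  filter_upwards [h6] with z hz hz'
  have := hz hz'
  simp only [hw] at this
  linarith

end WeakDerivatives

/-! ### L² rates in H^s and properties of Legendre coefficients -/

section ScalarRates

open Polynomial

/-- Scalar counterpart of `MemSobolev`, with the weak derivatives `D 0, …, D ⌊s⌋` given. -/
structure IsSobolevTower (s : ℝ) (D : ℕ → ℝ → ℝ) : Prop where
  memLp : ∀ k ≤ ⌊s⌋₊, MemLp (D k) 2 muI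
  weakDeriv : ∀ k ≤ ⌊s⌋₊, ∀ φ, IsTestFunction φ →
    ∫ z in Ixi, iteratedDeriv k φ z * D 0 z = (-1) ^ k * ∫ z in Ixi, φ z * D k z
  gagliardo_lt_top : (⌊s⌋₊ : ℝ) < s → gagliardo (s - ⌊s⌋₊) (D ⌊s⌋₊) < ⊤

/-- Comparing the identity of order k + 1 for φ with that of order k for φ' shows that D (k+1) is
the weak derivative of D k; du Bois-Reymond then applies. -/
theorem IsSobolevTower.exists_ae_eq_primitive {s : ℝ} {D : ℕ → ℝ → ℝ} (h : IsSobolevTower s D)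
    {k : ℕ} (hk : k + 1 ≤ ⌊s⌋₊) : ∃ c : ℝ, ∀ᵐ z ∂muI, D k z = c + primitive (D (k + 1)) z := by
  refine ae_eq_primitive_of_weakDeriv ((h.memLp k (by omega)).integrable one_le_two)
    ((h.memLp (k + 1) hk).integrable one_le_two) fun φ hφ => ?_
  have h1 := h.weakDeriv (k + 1) hk φ hφ
  have h2 := h.weakDeriv k (by omega) (deriv φ) hφ.deriv
  rw [iteratedDeriv_succ', h2, pow_succ, mul_assoc] at h1
  have h3 : ((-1 : ℝ) ^ k) ≠ 0 := pow_ne_zero _ (by norm_num)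
  have := mul_left_cancel₀ h3 h1
  linarith

theorem rpow_neg_le_two_rpow_mul {N : ℕ} (hN : 1 ≤ N) {t : ℝ} (ht : 0 ≤ t) :
    (N : ℝ) ^ (-t) ≤ 2 ^ t * ((N : ℝ) + 1) ^ (-t) := by
  have h1 : (1 : ℝ) ≤ N := by exact_mod_cast hN
  have h2 : ((N : ℝ) + 1) / 2 ≤ N := by linarith
  calc (N : ℝ) ^ (-t) ≤ (((N : ℝ) + 1) / 2) ^ (-t) :=
        Real.rpow_le_rpow_of_nonpos (by positivity) h2 (by linarith)
    _ = 2 ^ t * ((N : ℝ) + 1) ^ (-t) := by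
        rw [Real.div_rpow (by positivity) zero_le_two, Real.rpow_neg zero_le_two, div_inv_eq_mul,
          mul_comm]

/-- Induction downwards from the top order: the fractional Jackson inequality starts it, and each
lower order gains (N+1)^{-2} from Jackson applied modulo polynomials. -/
theorem IsSobolevTower.exists_sqDist_le {s : ℝ} (hs : 0 ≤ s) {D : ℕ → ℝ → ℝ}
    (h : IsSobolevTower s D) (i j : ℕ) (hij : j + i = ⌊s⌋₊) :
    ∃ C : ℝ, 0 ≤ C ∧ ∀ N : ℕ,
      sqDist (D j) (projPoly N (D j)) ≤ C * ((N : ℝ) + 1) ^ (-(2 * (s - j))) := by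
  have hfl : (⌊s⌋₊ : ℝ) ≤ s := Nat.floor_le hs
  induction i generalizing j with
  | zero =>
    obtain rfl : j = ⌊s⌋₊ := by omega
    rcases hfl.lt_or_eq with hlt | heq
    · exact exists_sqDist_projPoly_le_of_gagliardo (h.memLp _ le_rfl) (sub_pos.2 hlt)
        (h.gagliardo_lt_top hlt)
    -- For integer s no rate is needed at the top; comparison with the zero polynomial suffices.
    · refine ⟨sqDist (D ⌊s⌋₊) 0, sqDist_nonneg _ _, fun N => ?_⟩
      rw [show -(2 * (s - (⌊s⌋₊ : ℝ))) = 0 by rw [heq]; ring, Real.rpow_zero, mul_one]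
      exact sqDist_projPoly_le (h.memLp _ le_rfl) (by simp)
  | succ i ih =>
    obtain ⟨C, hC, hCN⟩ := ih (j + 1) (by omega)
    obtain ⟨c, hc⟩ := h.exists_ae_eq_primitive (k := j) (by omega)
    have hg := h.memLp (j + 1) (by omega)
    have hv := h.memLp j (by omega)
    have hvg := isPolyWeakDeriv_of_ae_eq_primitive (hg.integrable one_le_two) hc
    set t : ℝ := 2 * (s - ((j + 1 : ℕ) : ℝ)) with ht
    have ht0 : 0 ≤ t := by
      have : ((j + 1 : ℕ) : ℝ) ≤ ⌊s⌋₊ := by exact_mod_cast (by omega : j + 1 ≤ ⌊s⌋₊)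
      rw [ht]; linarith
    have hexp : ∀ N : ℕ, ((N : ℝ) + 1) ^ (-(2 * (s - j))) =
        ((N : ℝ) + 1) ^ (-t) / ((N : ℝ) + 1) ^ 2 := by
      intro N
      rw [← Real.rpow_natCast, ← Real.rpow_sub (by positivity)]
      congr 1
      rw [ht]; push_cast; ring
    -- The first summand covers N = 0. For N ≥ 1 the derivative is approximated in degree N - 1
    -- only, and 2^t is the cost of replacing N by N + 1.
    refine ⟨sqDist (D j) (projPoly 0 (D j)) + 3 * C * 2 ^ t,
      add_nonneg (sqDist_nonneg _ _) (by positivity), fun N => ?_⟩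
    rcases Nat.eq_zero_or_pos N with rfl | hN
    · simp only [Nat.cast_zero, zero_add, Real.one_rpow, mul_one]
      have : 0 ≤ 3 * C * 2 ^ t := by positivity
      linarith
    · have hq := natDegree_projPoly_le (N - 1) (D (j + 1))
      have h1 := sqDist_projPoly_le_sqDist_deriv hv hg hvg (N := N)
        (q := projPoly (N - 1) (D (j + 1))) (by omega)
      have h2 := hCN (N - 1)
      rw [Nat.cast_sub hN, Nat.cast_one, sub_add_cancel] at h2
      have h3 := rpow_neg_le_two_rpow_mul hN ht0
      calc _ ≤ _ := h1
        _ ≤ 3 / ((N : ℝ) + 1) ^ 2 * (C * (2 ^ t * ((N : ℝ) + 1) ^ (-t))) := by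
            gcongr
            exact h2.trans (by gcongr)
        _ = 3 * C * 2 ^ t * ((N : ℝ) + 1) ^ (-(2 * (s - j))) := by rw [hexp]; ring
        _ ≤ _ := by
            gcongr
            exact le_add_of_nonneg_left (sqDist_nonneg _ _)

theorem eval_eq_zero_of_polyIntegral_mul_self {p : ℝ[X]} (h : polyIntegral (p * p) = 0) :
    ∀ z ∈ Ixi, p.eval z = 0 := by
  have h1 : (fun z => (p * p).eval z) =ᵐ[muI] 0 :=
    (integral_eq_zero_iff_of_nonneg (fun z => by
      simp only [eval_mul, Pi.zero_apply]; exact mul_self_nonneg _) (integrable_eval _)).1 h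
  have h2 := Measure.eqOn_Icc_of_ae_eq volume (neg_lt_self sqrt_three_pos).ne h1
    (p * p).continuous.continuousOn continuousOn_const
  intro z hz
  have := h2 hz
  simpa using this

/-- The difference r of the two sides has degree at most N and is orthogonal to all such
polynomials, itself included, so it vanishes on the interval. -/
theorem eval_projPoly_sub {v : ℝ → ℝ} (hv : MemLp v 2 muI) {N : ℕ} {Q : ℝ[X]}
    (hQ : Q.natDegree ≤ N) {z : ℝ} (hz : z ∈ Ixi) :
    (projPoly N fun x => v x - Q.eval x).eval z = (projPoly N v).eval z - Q.eval z := by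
  set d : ℝ → ℝ := fun x => v x - Q.eval x with hd
  have hdm : MemLp d 2 muI := hv.sub (memLp_eval Q)
  set r := projPoly N d - (projPoly N v - Q) with hr
  have hrdeg : r.natDegree ≤ N :=
    (natDegree_sub_le _ _).trans (max_le (natDegree_projPoly_le N d)
      ((natDegree_sub_le _ _).trans (max_le (natDegree_projPoly_le N v) hQ)))
  have h1 : polyPairing hdm r = polyPairing hv r - polyIntegral (Q * r) := by
    simp only [polyPairing_apply, polyIntegral_apply, hd, sub_mul, eval_mul]
    refine integral_sub (hv.integrable_fun_mul (memLp_eval _)) ?_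
    simpa only [eval_mul] using integrable_eval (Q * r)
  rw [polyPairing_eq_of_natDegree_le hdm hrdeg, polyPairing_eq_of_natDegree_le hv hrdeg] at h1
  have h2 : polyIntegral (r * r) = 0 := by
    have : r * r = projPoly N d * r - (projPoly N v * r - Q * r) := by
      conv_lhs => rw [hr, sub_mul, sub_mul]
    rw [this, map_sub, map_sub, h1, sub_self]
  have h3 := eval_eq_zero_of_polyIntegral_mul_self h2 z hz
  rw [hr, eval_sub, eval_sub] at h3
  linarith

theorem legendreCoeff_sq_le {v : ℝ → ℝ} (hv : MemLp v 2 muI) (k : ℕ) :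
    legendreCoeff v k ^ 2 ≤ (2 * k + 1) / (2 * Real.sqrt 3) * ∫ z in Ixi, v z ^ 2 := by
  have hn := integral_Phi_sq_pos k
  have h1 := sq_integral_mul_le hv (memLp_eval (phiPoly k))
  rw [← polyPairing_apply hv, polyPairing_phiPoly, polyIntegral_phiPoly_self] at h1
  simp only [eval_phiPoly] at h1
  rw [mul_pow, sq (∫ z in Ixi, Phi k z ^ 2), ← mul_assoc] at h1
  have h2 := le_of_mul_le_mul_right h1 hn
  rw [integral_Phi_sq] at h2 hn
  have h3 := sqrt_three_pos
  rw [← le_div_iff₀ hn] at h2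
  refine h2.trans (le_of_eq ?_)
  field_simp

theorem Phi_zero (z : ℝ) : Phi 0 z = 1 := by
  simp [Phi, legendre]

/-- Legendre coefficients of `v` of positive index `k` vanish if those of its derivative vanish up
to the index `k + 1`. -/
theorem legendreCoeff_eq_zero_of_deriv {v g : ℝ → ℝ} (hv : MemLp v 2 muI) (hg : MemLp g 2 muI)
    (hvg : IsPolyWeakDeriv v g) {k M : ℕ} (hk : 0 < k) (hkM : k + 1 ≤ M)
    (h0 : ∀ p : ℝ[X], p.natDegree ≤ M → polyPairing hg p = 0) : legendreCoeff v k = 0 := by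
  -- The polynomial wΦ_k' has degree at most k + 1, and its derivative is a nonzero multiple of Φ_k.
  have h1 := hvg (weight * derivative (phiPoly k)) (by rw [eval_mul, eval_weight_sqrt, zero_mul])
    (by rw [eval_mul, eval_weight_neg_sqrt, zero_mul])
  have hw : weight.natDegree ≤ 2 := by
    rw [weight]
    exact (natDegree_sub_le _ _).trans (by simp)
  have hd : (weight * derivative (phiPoly k)).natDegree ≤ M := by
    refine natDegree_mul_le.trans ?_
    have := natDegree_derivative_le (phiPoly k)
    rw [natDegree_phiPoly] at this
    omega
  rw [← polyPairing_apply hg, h0 _ hd, weight_phiPoly_ode, ← polyPairing_apply hv,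
    ← smul_eq_C_mul, map_smul, polyPairing_phiPoly, polyIntegral_phiPoly_self, smul_eq_mul,
    neg_zero] at h1
  have hn := (integral_Phi_sq_pos k).ne'
  have hk' : (k : ℝ) ≠ 0 := by exact_mod_cast hk.ne'
  have hk1 : (k : ℝ) + 1 ≠ 0 := by positivity
  simpa [hn, hk', hk1] using h1

end ScalarRates

/-! ### From L² rates of the derivative to uniform rates -/

section UniformRates

open Polynomial

theorem sq_sub_sq_primitive {γ : ℝ → ℝ} (hγ : Integrable γ muI) (c : ℝ) {y z : ℝ} (hy : y ∈ Ixi)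
    (hz : z ∈ Ixi) : (c + primitive γ z) ^ 2 - (c + primitive γ y) ^ 2 =
      2 * ∫ t in y..z, (c + primitive γ t) * γ t := by
  have hγi := hγ.intervalIntegrable_Ixi
  have hsub : uIcc y z ⊆ uIcc (-Real.sqrt 3) (Real.sqrt 3) := by
    rw [uIcc_sqrt_three]
    exact uIcc_subset_Icc hy hz
  have hac : AbsolutelyContinuousOnInterval (fun t => c + primitive γ t) y z := by
    refine AbsolutelyContinuousOnInterval.mono ?_ hsub
    exact (contDiffOn_const (c := c)).absolutelyContinuousOnInterval.add
      (hγi.absolutelyContinuousOnInterval_intervalIntegral left_mem_uIcc)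
  have h := hac.integral_mul_deriv_eq_deriv_mul hac
  have hd : ∀ᵐ t, t ∈ uIoc y z → deriv (fun t => c + primitive γ t) t = γ t := by
    filter_upwards [hγi.ae_hasDerivAt_integral] with t ht ht'
    exact ((ht (hsub (uIoc_subset_uIcc ht')) _ left_mem_uIcc).const_add c).deriv
  rw [intervalIntegral.integral_congr_ae (g := fun t => (c + primitive γ t) * γ t)
      (hd.mono fun t ht ht' => by simp only [ht ht']),
    intervalIntegral.integral_congr_ae (g := fun t => (c + primitive γ t) * γ t)
      (f := fun t => deriv (fun t => c + primitive γ t) t * (c + primitive γ t))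
      (hd.mono fun t ht ht' => by simp only [ht ht', mul_comm])] at h
  linear_combination -h

/-- An interpolation inequality of Gagliardo–Nirenberg type for functions of mean zero. -/
theorem sq_le_of_integral_eq_zero {d γ : ℝ → ℝ} {c : ℝ} (hγ : MemLp γ 2 muI)
    (hd : ∀ z ∈ Ixi, d z = c + primitive γ z) (h0 : ∫ z in Ixi, d z = 0) {A : ℝ} (hA : 0 ≤ A)
    (hdA : (∫ z in Ixi, d z ^ 2) * ∫ z in Ixi, γ z ^ 2 ≤ A ^ 2) {z : ℝ} (hz : z ∈ Ixi) :
    d z ^ 2 ≤ 2 * A := by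
  have hγi := hγ.integrable one_le_two
  have hdc : ContinuousOn d Ixi :=
    (continuousOn_const.add (continuousOn_primitive hγi)).congr hd
  have hdm := hdc.memLp_Ixi 2
  have hdi : IntegrableOn d Ixi := hdc.integrable_Ixi
  -- A continuous function of mean zero has a zero y; then d(z)² = 2∫_y^z dγ, to be bounded by
  -- Cauchy–Schwarz.
  obtain ⟨y, hy, hy0⟩ : ∃ y ∈ Ixi, d y = 0 := by
    have hvol : volume Ixi ≠ 0 := by
      rw [volume_Ixi]; simp
    have hne : volume Ixi ≠ ⊤ := by rw [volume_Ixi]; exact ENNReal.ofReal_ne_top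
    have hav : ⨍ z in Ixi, d z = 0 := by rw [setAverage_eq, h0, smul_zero]
    obtain ⟨x₁, hx₁, h1⟩ := exists_le_setAverage hvol hne hdi
    obtain ⟨x₂, hx₂, h2⟩ := exists_setAverage_le hvol hne hdi
    rw [hav] at h1 h2
    exact isPreconnected_Icc.intermediate_value hx₁ hx₂ hdc ⟨h1, h2⟩
  have h1 := sq_sub_sq_primitive hγi c hy hz
  rw [← hd z hz, ← hd y hy, hy0] at h1
  have hsub : uIoc y z ⊆ Ixi := uIoc_subset_uIcc.trans (uIcc_subset_Icc hy hz)
  have habs : MemLp (fun t => |d t|) 2 muI := hdm.abs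
  have hγabs : MemLp (fun t => |γ t|) 2 muI := hγ.abs
  have h2 : |∫ t in y..z, (c + primitive γ t) * γ t| ≤ ∫ t in Ixi, |d t| * |γ t| := by
    rw [← Real.norm_eq_abs]
    refine intervalIntegral.norm_integral_le_integral_norm_uIoc.trans ?_
    rw [setIntegral_congr_fun (g := fun t => |d t| * |γ t|) measurableSet_uIoc (fun t ht => by
      simp only [Real.norm_eq_abs, abs_mul, hd t (hsub ht)])]
    exact setIntegral_mono_set (habs.integrable_fun_mul hγabs)
      (Eventually.of_forall fun t => by simp only [Pi.zero_apply]; positivity)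
      (Eventually.of_forall hsub)
  have h3 := sq_integral_mul_le habs hγabs
  simp only [sq_abs] at h3
  have h4 : ∫ t in Ixi, |d t| * |γ t| ≤ A :=
    le_of_sq_le_sq (h3.trans hdA) hA
  linarith [le_abs_self (∫ t in y..z, (c + primitive γ t) * γ t)]

/-- Gains only half a power over the L² error of the derivative, as the interpolation inequality
allows. Bounding every term of the expansion separately is avoided: after subtracting a suitable Q
only two terms remain. -/
theorem sq_sub_eval_projPoly_le {u g : ℝ → ℝ} {c : ℝ} (hu : ContinuousOn u Ixi)
    (hg : MemLp g 2 muI) (h : ∀ᵐ z ∂muI, u z = c + primitive g z) (M : ℕ) {z : ℝ} (hz : z ∈ Ixi) :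
    (u z - (projPoly (M + 2) u).eval z) ^ 2 ≤
      42 / ((M : ℝ) + 1) * sqDist g (projPoly (M + 1) g) := by
  have h3 := sqrt_three_pos
  have hgi := hg.integrable one_le_two
  have hum := hu.memLp_Ixi 2
  have hM : (0 : ℝ) < (M : ℝ) + 1 := by positivity
  have huall : ∀ z ∈ Ixi, u z = c + primitive g z :=
    Measure.eqOn_Icc_of_ae_eq volume (neg_lt_self h3).ne h hu
      (continuousOn_const.add (continuousOn_primitive hgi))
  have hug := isPolyWeakDeriv_of_ae_eq_primitive hgi h
  set q := projPoly (M + 1) g with hq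
  obtain ⟨Q₀, hQ₀, hQ₀q⟩ := exists_natDegree_le_derivative_eq q
  -- The constant of integration is the mean of u - Q₀, so that d has mean zero; this kills its
  -- coefficient of index zero.
  set κ : ℝ := (∫ z in Ixi, (u z - Q₀.eval z)) / (2 * Real.sqrt 3) with hκ
  set Q : ℝ[X] := Q₀ + C κ with hQ
  have hQq : derivative Q = q := by rw [hQ, derivative_add, derivative_C, add_zero, hQ₀q]
  have hQdeg : Q.natDegree ≤ M + 2 := by
    rw [hQ, natDegree_add_C]
    exact hQ₀.trans (by have : q.natDegree ≤ M + 1 := natDegree_projPoly_le (M + 1) g; omega)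
  set d : ℝ → ℝ := fun z => u z - Q.eval z with hd
  set γ : ℝ → ℝ := fun z => g z - q.eval z with hγ
  have hdm : MemLp d 2 muI := hum.sub (memLp_eval Q)
  have hγm : MemLp γ 2 muI := hg.sub (memLp_eval q)
  have hdγ : IsPolyWeakDeriv d γ := by
    have := hug.sub_eval hum hg Q
    rwa [hQq] at this
  set E := sqDist g q with hE
  have hE0 : 0 ≤ E := sqDist_nonneg _ _
  have hγE : ∫ z in Ixi, γ z ^ 2 = E := rfl
  have hd0 : ∫ z in Ixi, d z = 0 := by
    have h1 : Integrable (fun z => u z - Q₀.eval z) muI :=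
      (hum.sub (memLp_eval Q₀)).integrable one_le_two
    simp only [hd, hQ, eval_add, eval_C, ← sub_sub]
    rw [integral_sub h1 (integrable_const κ), setIntegral_const, Measure.real, volume_Ixi,
      ENNReal.toReal_ofReal (by positivity), smul_eq_mul, hκ, mul_div_cancel₀ _ (by positivity),
      sub_self]
  have hpair : ∀ p : ℝ[X], p.natDegree ≤ M + 1 → polyPairing hγm p = 0 := by
    intro p hp
    have h1 : polyPairing hγm p = polyPairing hg p - polyIntegral (q * p) := by
      simp only [polyPairing_apply, polyIntegral_apply, hγ, sub_mul, eval_mul]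
      refine integral_sub (hg.integrable_fun_mul (memLp_eval _)) ?_
      simpa only [eval_mul] using integrable_eval (q * p)
    rw [h1, polyPairing_eq_of_natDegree_le hg hp, sub_self]
  have hcoeff : ∀ k ≤ M, legendreCoeff d k = 0 := by
    intro k hk
    rcases Nat.eq_zero_or_pos k with rfl | hk0
    · simp only [legendreCoeff, Phi_zero, one_mul, hd0, mul_zero]
    · exact legendreCoeff_eq_zero_of_deriv hdm hγm hdγ hk0 (by omega) hpair
  have hproj : projPoly M d = 0 :=
    Finset.sum_eq_zero fun k hk => by
      rw [hcoeff k (Nat.lt_succ_iff.1 (Finset.mem_range.1 hk)), C_0, zero_mul]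
  have hdE : ∫ z in Ixi, d z ^ 2 ≤ 3 / ((M : ℝ) + 1) ^ 2 * E := by
    have := sqDist_projPoly_le_of_weakDeriv hdm hγm hdγ M
    rw [hproj, hγE] at this
    simpa [sqDist] using this
  have hdprim : ∀ z ∈ Ixi, d z = (c - Q.eval (-Real.sqrt 3)) + primitive γ z := by
    intro z hz
    have h1 : primitive γ z = primitive g z - ∫ t in (-Real.sqrt 3)..z, q.eval t := by
      refine intervalIntegral.integral_sub ?_ (q.continuous.intervalIntegrable _ _)
      refine hgi.intervalIntegrable_Ixi.mono_set ?_
      rw [uIcc_sqrt_three]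
      exact uIcc_subset_Icc ⟨le_rfl, neg_sqrt_three_le⟩ hz
    have h2 : ∫ t in (-Real.sqrt 3)..z, q.eval t = Q.eval z - Q.eval (-Real.sqrt 3) := by
      rw [← hQq]
      exact intervalIntegral.integral_eq_sub_of_hasDerivAt (fun x _ => Q.hasDerivAt x)
        ((derivative Q).continuous.intervalIntegrable _ _)
    simp only [hd]
    rw [h1, h2, huall z hz]
    ring
  -- Jackson's constant 3 is rounded up to 4 to make the bound on ‖d‖²‖γ‖² a perfect square.
  have hdz : d z ^ 2 ≤ 4 / ((M : ℝ) + 1) * E := by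
    have h1 := sq_le_of_integral_eq_zero hγm hdprim hd0 (A := 2 / ((M : ℝ) + 1) * E)
      (by positivity) (by
        rw [hγE]
        calc _ ≤ 3 / ((M : ℝ) + 1) ^ 2 * E * E := by gcongr
          _ ≤ 4 / ((M : ℝ) + 1) ^ 2 * E * E := by gcongr; norm_num
          _ = _ := by field_simp; ring) hz
    refine h1.trans (le_of_eq ?_)
    ring
  have hcz : ∀ k ≤ M + 2, (legendreCoeff d k * Phi k z) ^ 2 ≤ 5 / ((M : ℝ) + 1) * E := by
    intro k hk
    have h1 := legendreCoeff_sq_le hdm k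
    have h2 : Phi k z ^ 2 ≤ 1 := (sq_le_one_iff_abs_le_one _).2 (abs_Phi_le_one k hz)
    have hk' : (k : ℝ) ≤ M + 2 := by exact_mod_cast hk
    have hs3 : 3 / 2 ≤ Real.sqrt 3 := by
      rw [Real.le_sqrt' (by norm_num)]; norm_num
    -- With √3 ≥ 3/2 this follows from 2k + 1 ≤ 2M + 5 ≤ 5(M + 1).
    have h4 : (2 * (k : ℝ) + 1) / (2 * Real.sqrt 3) ≤ 5 * ((M : ℝ) + 1) / 3 := by
      rw [div_le_div_iff₀ (by positivity) (by norm_num)]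
      nlinarith [(Nat.cast_nonneg M : (0 : ℝ) ≤ M)]
    have hdd : 0 ≤ ∫ z in Ixi, d z ^ 2 := integral_nonneg fun _ => sq_nonneg _
    calc (legendreCoeff d k * Phi k z) ^ 2 = legendreCoeff d k ^ 2 * Phi k z ^ 2 := mul_pow _ _ _
      _ ≤ legendreCoeff d k ^ 2 := mul_le_of_le_one_right (sq_nonneg _) h2
      _ ≤ 5 * ((M : ℝ) + 1) / 3 * (3 / ((M : ℝ) + 1) ^ 2 * E) := h1.trans (by gcongr)
      _ = 5 / ((M : ℝ) + 1) * E := by field_simp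
  -- Q has degree at most M + 2, so u and d have the same projection error; the coefficients of d up
  -- to index M vanish.
  have heq : u z - (projPoly (M + 2) u).eval z = d z -
      (legendreCoeff d (M + 1) * Phi (M + 1) z + legendreCoeff d (M + 2) * Phi (M + 2) z) := by
    have h1 := eval_projPoly_sub hum hQdeg hz
    have h2 : (projPoly (M + 2) d).eval z =
        legendreCoeff d (M + 1) * Phi (M + 1) z + legendreCoeff d (M + 2) * Phi (M + 2) z := by
      have h4 : projPoly (M + 2) d = projPoly M d + C (legendreCoeff d (M + 1)) * phiPoly (M + 1)
          + C (legendreCoeff d (M + 2)) * phiPoly (M + 2) := by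
        simp only [projPoly, Finset.sum_range_succ]
      rw [h4, hproj, zero_add, eval_add, eval_mul, eval_mul, eval_C, eval_C, eval_phiPoly,
        eval_phiPoly]
    rw [← h2]
    simp only [hd] at h1 ⊢
    linarith
  rw [heq]
  set x₁ := legendreCoeff d (M + 1) * Phi (M + 1) z
  set x₂ := legendreCoeff d (M + 2) * Phi (M + 2) z
  have e1 : x₁ ^ 2 ≤ 5 / ((M : ℝ) + 1) * E := hcz (M + 1) (by omega)
  have e2 : x₂ ^ 2 ≤ 5 / ((M : ℝ) + 1) * E := hcz (M + 2) le_rfl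
  have e3 : (d z - (x₁ + x₂)) ^ 2 ≤ 3 * (d z ^ 2 + x₁ ^ 2 + x₂ ^ 2) := by
    nlinarith [sq_nonneg (d z + x₁), sq_nonneg (d z + x₂), sq_nonneg (x₁ - x₂)]
  calc _ ≤ _ := e3
    _ ≤ 3 * (4 / ((M : ℝ) + 1) * E + 5 / ((M : ℝ) + 1) * E + 5 / ((M : ℝ) + 1) * E) := by
      gcongr
    _ = 42 / ((M : ℝ) + 1) * E := by ring

end UniformRates

/-! ### Reduction of the vector-valued statements to components -/

section VectorValued

open Polynomial

variable {n : ℕ}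

/-- The squared L² error of the first derivative is of order N^{-2(s-1)}, and the uniform estimate
multiplies it by 1/N. -/
theorem IsSobolevTower.exists_sq_sub_eval_le {s : ℝ} (hs : 1 ≤ s) {D : ℕ → ℝ → ℝ}
    (h : IsSobolevTower s D) (hc : ContinuousOn (D 0) Ixi) :
    ∃ C : ℝ, 0 ≤ C ∧ ∀ N : ℕ, 2 ≤ N → ∀ z ∈ Ixi,
      (D 0 z - (projPoly N (D 0)).eval z) ^ 2 ≤ C * ((N : ℝ) ^ (1 / 2 - s)) ^ 2 := by
  have hm : 1 ≤ ⌊s⌋₊ := Nat.le_floor (by simpa using hs)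
  obtain ⟨C, hC, hCN⟩ := h.exists_sqDist_le (by linarith) (⌊s⌋₊ - 1) 1 (by omega)
  obtain ⟨c, hc0⟩ := h.exists_ae_eq_primitive (k := 0) (by omega)
  refine ⟨126 * C, by positivity, fun N hN z hz => ?_⟩
  obtain ⟨M, rfl⟩ : ∃ M, N = M + 2 := ⟨N - 2, by omega⟩
  have h1 := sq_sub_eval_projPoly_le hc (h.memLp 1 hm) hc0 M hz
  have h2 := hCN (M + 1)
  have hx : ((M + 1 : ℕ) : ℝ) + 1 = ((M + 2 : ℕ) : ℝ) := by push_cast; ring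
  rw [hx] at h2
  set x : ℝ := ((M + 2 : ℕ) : ℝ) with hxdef
  have hxM : x = (M : ℝ) + 2 := by rw [hxdef]; push_cast; ring
  have hM : (0 : ℝ) ≤ M := Nat.cast_nonneg M
  have hx0 : 0 < x := by rw [hxM]; positivity
  have hexp : (x ^ (1 / 2 - s)) ^ 2 = x ^ (-(2 * (s - (1 : ℕ)))) / x := by
    rw [← Real.rpow_natCast, ← Real.rpow_mul hx0.le]
    nth_rewrite 3 [← Real.rpow_one x]
    rw [← Real.rpow_sub hx0]
    congr 1
    push_cast
    ring
  have hinv : 42 / ((M : ℝ) + 1) ≤ 126 / x := by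
    rw [div_le_div_iff₀ (by positivity) hx0, hxM]
    linarith
  calc _ ≤ _ := h1
    _ ≤ 126 / x * (C * x ^ (-(2 * (s - (1 : ℕ))))) :=
        mul_le_mul hinv h2 (sqDist_nonneg _ _) (by positivity)
    _ = 126 * C * (x ^ (1 / 2 - s)) ^ 2 := by rw [hexp]; ring

theorem integral_ofLp_apply {v : ℝ → E n} (hv : Integrable v muI) (i : Fin n) :
    (∫ z in Ixi, v z) i = ∫ z in Ixi, v z i :=
  ((EuclideanSpace.proj (𝕜 := ℝ) i).integral_comp_comm hv).symm

theorem _root_.MeasureTheory.MemLp.component {v : ℝ → E n} (hv : MemLp v 2 muI) (i : Fin n) :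
    MemLp (fun z => v z i) 2 muI :=
  (EuclideanSpace.proj (𝕜 := ℝ) i).comp_memLp' hv

theorem continuous_Phi (k : ℕ) : Continuous (Phi k) := by
  simpa only [eval_phiPoly] using (phiPoly k).continuous

theorem integrable_bdd_smul {φ : ℝ → ℝ} (hφ : Continuous φ) {v : ℝ → E n}
    (hv : MemLp v 2 muI) : Integrable (fun z => φ z • v z) muI := by
  obtain ⟨C, hC⟩ := isCompact_Ixi.exists_bound_of_continuousOn hφ.continuousOn
  exact (hv.integrable one_le_two).bdd_smul C hφ.aestronglyMeasurable
    ((ae_restrict_iff' measurableSet_Ixi).2 (Eventually.of_forall hC))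

theorem lsProj_apply {v : ℝ → E n} (hv : MemLp v 2 muI) (N : ℕ) (z : ℝ) (i : Fin n) :
    lsProj N v z i = (projPoly N fun x => v x i).eval z := by
  rw [lsProj, projPoly, eval_finsetSum, WithLp.ofLp_sum, Finset.sum_apply]
  refine Finset.sum_congr rfl fun k _ => ?_
  simp only [PiLp.smul_apply, smul_eq_mul, eval_mul, eval_C, eval_phiPoly, legendreCoeff, moment]
  rw [integral_ofLp_apply (integrable_bdd_smul (continuous_Phi k) hv)]
  simp only [PiLp.smul_apply, smul_eq_mul]
  ring

theorem normL2_eq {w : ℝ → E n} (hw : MemLp w 2 muI) :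
    normL2 w = ENNReal.ofReal (Real.sqrt (∑ i, ∫ z in Ixi, w z i ^ 2)) := by
  rw [normL2, hw.eLpNorm_eq_integral_rpow_norm two_ne_zero ENNReal.ofNat_ne_top,
    ← integral_finsetSum _ fun i _ => (hw.component i).integrable_sq, Real.sqrt_eq_rpow]
  simp [EuclideanSpace.norm_sq_eq]

theorem continuous_of_isPolyOfDegreeLE {N : ℕ} {p : ℝ → E n} (hp : IsPolyOfDegreeLE N p) :
    Continuous p := by
  refine (PiLp.continuous_toLp 2 _).comp (continuous_pi fun i => ?_)
  obtain ⟨q, -, hq⟩ := hp i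
  simpa only [hq] using q.continuous

theorem isPolyOfDegreeLE_lsProj {v : ℝ → E n} (hv : MemLp v 2 muI) (N : ℕ) :
    IsPolyOfDegreeLE N (lsProj N v) := fun i =>
  ⟨_, natDegree_projPoly_le N fun x => v x i, fun z => lsProj_apply hv N z i⟩

theorem continuous_lsProj {v : ℝ → E n} (hv : MemLp v 2 muI) (N : ℕ) :
    Continuous (lsProj N v) :=
  continuous_of_isPolyOfDegreeLE (isPolyOfDegreeLE_lsProj hv N)

theorem normL2_sub_lsProj {v : ℝ → E n} (hv : MemLp v 2 muI) (N : ℕ) :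
    normL2 (fun z => v z - lsProj N v z) = ENNReal.ofReal
      (Real.sqrt (∑ i, sqDist (fun z => v z i) (projPoly N fun z => v z i))) := by
  have hm : MemLp (fun z => v z - lsProj N v z) 2 muI :=
    hv.sub ((continuous_lsProj hv N).continuousOn.memLp_Ixi 2)
  rw [normL2_eq hm]
  simp only [PiLp.sub_apply, lsProj_apply hv, sqDist]

theorem isBestL2Approx_lsProj {v : ℝ → E n} (hv : MemLp v 2 muI) (N : ℕ) :
    IsBestL2Approx N v (lsProj N v) := by
  refine ⟨isPolyOfDegreeLE_lsProj hv N, fun q hq => ?_⟩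
  have hm : MemLp (fun z => v z - q z) 2 muI :=
    hv.sub ((continuous_of_isPolyOfDegreeLE hq).continuousOn.memLp_Ixi 2)
  rw [normL2_sub_lsProj hv, normL2_eq hm]
  refine ENNReal.ofReal_le_ofReal (Real.sqrt_le_sqrt (Finset.sum_le_sum fun i _ => ?_))
  obtain ⟨p, hpN, hp⟩ := hq i
  simp only [PiLp.sub_apply, hp]
  exact sqDist_projPoly_le (hv.component i) hpN

theorem MemSobolev.exists_isSobolevTower {s : ℝ} {v : ℝ → E n} (h : MemSobolev s v) (i : Fin n) :
    ∃ D : ℕ → ℝ → ℝ, D 0 = (fun z => v z i) ∧ IsSobolevTower s D := by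
  obtain ⟨D, hD0, hD, hG⟩ := h
  refine ⟨fun k z => D k z i, by simp only [hD0], ⟨fun k hk => (hD k hk).1.component i, ?_, ?_⟩⟩
  · intro k hk φ hφ
    have h0 := (hD 0 (Nat.zero_le _)).1
    have h1 := (hD k hk).2 φ hφ.contDiff hφ.hasCompactSupport hφ.tsupport_subset
    have h2 := congrArg (fun x : E n => x i) h1
    have hc : Continuous (iteratedDeriv k φ) :=
      hφ.contDiff.continuous_iteratedDeriv k (by exact_mod_cast le_top)
    simp only [PiLp.smul_apply, smul_eq_mul] at h2
    rw [← hD0, integral_ofLp_apply (integrable_bdd_smul hc h0),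
      integral_ofLp_apply (integrable_bdd_smul hφ.continuous (hD k hk).1)] at h2
    simpa only [PiLp.smul_apply, smul_eq_mul] using h2
  · intro hlt
    refine lt_of_le_of_lt ?_ (hG hlt)
    refine lintegral_mono fun x => lintegral_mono fun y => ENNReal.ofReal_le_ofReal ?_
    gcongr
    exact PiLp.norm_apply_le (D ⌊s⌋₊ x - D ⌊s⌋₊ y) i

/-- Uniform convergence of the Legendre projection of a continuous `H^s` function. -/
theorem MemSobolev.exists_norm_sub_lsProj_le {s : ℝ} (hs : 1 ≤ s) {v : ℝ → E n}
    (h : MemSobolev s v) (hv : ContinuousOn v Ixi) :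
    ∃ A : ℝ, 0 ≤ A ∧ ∀ N : ℕ, 2 ≤ N → ∀ z ∈ Ixi,
      ‖v z - lsProj N v z‖ ≤ A * (N : ℝ) ^ (1 / 2 - s) := by
  have hvm := hv.memLp_Ixi 2
  have hcomp : ∀ i : Fin n, ∃ C : ℝ, 0 ≤ C ∧ ∀ N : ℕ, 2 ≤ N → ∀ z ∈ Ixi,
      (v z i - (projPoly N fun x => v x i).eval z) ^ 2 ≤ C * ((N : ℝ) ^ (1 / 2 - s)) ^ 2 := by
    intro i
    obtain ⟨D, hD0, hD⟩ := h.exists_isSobolevTower i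
    have := hD.exists_sq_sub_eval_le hs (by
      rw [hD0]
      exact (EuclideanSpace.proj (𝕜 := ℝ) i).continuous.comp_continuousOn hv)
    simpa only [hD0] using this
  choose C hC hCN using hcomp
  refine ⟨Real.sqrt (∑ i, C i), Real.sqrt_nonneg _, fun N hN z hz => ?_⟩
  have hC0 : 0 ≤ ∑ i, C i := Finset.sum_nonneg fun i _ => hC i
  refine abs_le_of_sq_le_sq' ?_ (by positivity) |>.2
  rw [mul_pow, Real.sq_sqrt hC0, Finset.sum_mul, EuclideanSpace.real_norm_sq_eq]
  refine Finset.sum_le_sum fun i _ => ?_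
  rw [PiLp.sub_apply, lsProj_apply hvm]
  exact hCN i N hN z hz

theorem MemSobolev.exists_normL2_sub_lsProj_le {s : ℝ} (hs : 0 ≤ s) {v : ℝ → E n}
    (h : MemSobolev s v) (hvm : MemLp v 2 muI) :
    ∃ A : ℝ, 0 ≤ A ∧ ∀ N : ℕ, 1 ≤ N →
      normL2 (fun z => v z - lsProj N v z) ≤ ENNReal.ofReal (A * (N : ℝ) ^ (-s)) := by
  have hcomp : ∀ i : Fin n, ∃ C : ℝ, 0 ≤ C ∧ ∀ N : ℕ,
      sqDist (fun z => v z i) (projPoly N fun x => v x i) ≤ C * ((N : ℝ) + 1) ^ (-(2 * s)) := by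
    intro i
    obtain ⟨D, hD0, hD⟩ := h.exists_isSobolevTower i
    have := hD.exists_sqDist_le hs ⌊s⌋₊ 0 (by omega)
    simpa only [hD0, Nat.cast_zero, sub_zero] using this
  choose C hC hCN using hcomp
  refine ⟨Real.sqrt (∑ i, C i), Real.sqrt_nonneg _, fun N hN => ?_⟩
  have hN0 : (0 : ℝ) < N := by exact_mod_cast hN
  have hC0 : 0 ≤ ∑ i, C i := Finset.sum_nonneg fun i _ => hC i
  rw [normL2_sub_lsProj hvm]
  refine ENNReal.ofReal_le_ofReal (Real.sqrt_le_iff.2 ⟨by positivity, ?_⟩)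
  rw [mul_pow, Real.sq_sqrt hC0, Finset.sum_mul]
  refine Finset.sum_le_sum fun i _ => (hCN i N).trans ?_
  have : ((N : ℝ) ^ (-s)) ^ 2 = (N : ℝ) ^ (-(2 * s)) := by
    rw [← Real.rpow_natCast, ← Real.rpow_mul hN0.le]
    congr 1
    push_cast
    ring
  rw [this]
  refine mul_le_mul_of_nonneg_left ?_ (hC i)
  exact Real.rpow_le_rpow_of_nonpos hN0 (by linarith) (by linarith)

end VectorValued

/-! ### Parameter range, norm comparisons and bounds for the residual -/

section Residual

variable {n : ℕ}

theorem param_mem_Icc {a b : ℝ} (hab : a < b) {z : ℝ} (hz : z ∈ Ixi) :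
    paramMean a b + paramStd a b * z ∈ Icc a b := by
  have h3 := sqrt_three_pos
  rw [paramMean_eq hab, paramStd_eq hab]
  have hk : (b - a) / (2 * Real.sqrt 3) * Real.sqrt 3 = (b - a) / 2 := by field_simp
  have hc : 0 ≤ (b - a) / (2 * Real.sqrt 3) := div_nonneg (by linarith) (by positivity)
  have h1 := mul_le_mul_of_nonneg_left hz.2 hc
  have h2 := mul_le_mul_of_nonneg_left hz.1 hc
  rw [mul_neg] at h2
  constructor <;> linarith

theorem continuousOn_reparam {a b : ℝ} (hab : a < b) {u : ℝ → E n}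
    (hu : ContinuousOn u (Icc a b)) : ContinuousOn (reparam a b u) Ixi :=
  hu.comp (by fun_prop) fun _ hz => param_mem_Icc hab hz

theorem continuousOn_nemytskii {a b : ℝ} (hab : a < b) {f : E n → ℝ → E n}
    (hf : IsAdmissible a b f) {v : ℝ → E n} (hv : ContinuousOn v Ixi) :
    ContinuousOn (nemytskii a b f v) Ixi :=
  hf.continuousOn.comp (f := fun z => (v z, paramMean a b + paramStd a b * z))
    (hv.prodMk (by fun_prop)) fun _ hz => ⟨mem_univ _, param_mem_Icc hab hz⟩

theorem normLinf_le_of_forall {w : ℝ → E n} {c : ℝ} (h : ∀ z ∈ Ixi, ‖w z‖ ≤ c) :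
    normLinf w ≤ ENNReal.ofReal c := by
  rw [normLinf, eLpNorm_exponent_top]
  exact eLpNormEssSup_le_of_ae_bound
    ((ae_restrict_iff' measurableSet_Ixi).2 (Eventually.of_forall h))

theorem eLpNorm_Ixi_le_mul {w v : ℝ → E n} {c : ℝ} (h : ∀ z ∈ Ixi, ‖w z‖ ≤ c * ‖v z‖) (p : ℝ≥0∞) :
    eLpNorm w p muI ≤ ENNReal.ofReal c * eLpNorm v p muI :=
  eLpNorm_le_mul_eLpNorm_of_ae_le_mul
    ((ae_restrict_iff' measurableSet_Ixi).2 (Eventually.of_forall h)) p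

theorem isBigOPow_of_le {e : ℕ → ℝ≥0∞} {A r r' : ℝ} (hA : 0 ≤ A) (hr : r ≤ r') {N₀ : ℕ}
    (h : ∀ N : ℕ, N₀ ≤ N → e N ≤ ENNReal.ofReal (A * (N : ℝ) ^ r)) : IsBigOPow e r' := by
  -- A may be zero, while the definition asks for a positive constant.
  refine ⟨A + 1, by positivity, ?_⟩
  filter_upwards [eventually_ge_atTop (max N₀ 1)] with N hN
  have h1 : (1 : ℝ) ≤ N := by exact_mod_cast (le_max_right _ _).trans hN
  refine (h N ((le_max_left _ _).trans hN)).trans (ENNReal.ofReal_le_ofReal ?_)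
  exact mul_le_mul (by linarith) (Real.rpow_le_rpow_of_exponent_le h1 hr) (by positivity)
    (by positivity)

theorem IsBigOPow.of_le_mul {e e' : ℕ → ℝ≥0∞} {r c : ℝ} (h : IsBigOPow e r) (hc : 0 < c)
    (he : ∀ N, e' N ≤ ENNReal.ofReal c * e N) : IsBigOPow e' r := by
  obtain ⟨K, hK, hN⟩ := h
  refine ⟨c * K, by positivity, hN.mono fun N hN => (he N).trans ?_⟩
  rw [mul_assoc, ENNReal.ofReal_mul hc.le]
  gcongr

/-- A uniformly convergent sequence of continuous functions on `I_ξ` is uniformly bounded. -/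
theorem exists_forall_norm_le {v : ℝ → E n} {w : ℕ → ℝ → E n} (hv : ContinuousOn v Ixi)
    (hw : ∀ N, ContinuousOn (w N) Ixi) {A : ℝ} {N₀ : ℕ}
    (h : ∀ N, N₀ ≤ N → ∀ z ∈ Ixi, ‖v z - w N z‖ ≤ A) :
    ∃ R : ℝ, 0 < R ∧ ∀ z ∈ Ixi, ‖v z‖ ≤ R ∧ ∀ N, ‖w N z‖ ≤ R := by
  obtain ⟨B, hB⟩ := isCompact_Ixi.exists_bound_of_continuousOn hv
  choose c hc using fun N => isCompact_Ixi.exists_bound_of_continuousOn (hw N)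
  have hsum : ∀ N ∈ Finset.range N₀, |c N| ≤ ∑ N ∈ Finset.range N₀, |c N| := fun N hN =>
    Finset.single_le_sum (f := fun N => |c N|) (fun _ _ => abs_nonneg _) hN
  have hS : 0 ≤ ∑ N ∈ Finset.range N₀, |c N| := Finset.sum_nonneg fun _ _ => abs_nonneg _
  refine ⟨|B| + |A| + ∑ N ∈ Finset.range N₀, |c N| + 1, by positivity, fun z hz => ⟨?_, fun N => ?_⟩⟩
  · linarith [hB z hz, le_abs_self B, abs_nonneg A]
  · rcases lt_or_ge N N₀ with hN | hN
    · linarith [hc N z hz, le_abs_self (c N), hsum N (Finset.mem_range.2 hN), abs_nonneg A,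
        abs_nonneg B]
    · have h1 := norm_sub_norm_le (w N z) (v z)
      rw [norm_sub_rev] at h1
      linarith [h N hN z hz, hB z hz, le_abs_self A, le_abs_self B]

theorem norm_moment_le {v : ℝ → E n} {c : ℝ} (h : ∀ z ∈ Ixi, ‖v z‖ ≤ c) (l : ℕ) :
    ‖moment v l‖ ≤ c * volume.real Ixi := by
  refine norm_setIntegral_le_of_norm_le_const
    (by rw [volume_Ixi]; exact ENNReal.ofReal_lt_top) fun z hz => ?_
  rw [norm_smul, Real.norm_eq_abs]
  exact (mul_le_of_le_one_left (norm_nonneg _) (abs_Phi_le_one l hz)).trans (h z hz)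

end Residual

end PolyChaos

/-! ### The consistency theorem -/

theorem mainTheorem3 (n : ℕ) (a b : ℝ) (hab : a < b)
    (f : PolyChaos.E n → ℝ → PolyChaos.E n) (hf : PolyChaos.IsAdmissible a b f)
    (u : ℝ → PolyChaos.E n) (hu : PolyChaos.IsSolutionBranch a b f u)
    (s : ℝ) (hs : 1 ≤ s) (hus : PolyChaos.MemSobolev s (PolyChaos.reparam a b u)) :
    let ubar : ℝ → PolyChaos.E n := PolyChaos.reparam a b u
    let uLS : ℕ → ℝ → PolyChaos.E n := fun N => PolyChaos.lsProj N ubar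
    let err : ℕ → ℝ → PolyChaos.E n := fun N z => ubar z - uLS N z
    let res : ℕ → ℝ → PolyChaos.E n := fun N => PolyChaos.nemytskii a b f (uLS N)
    (∀ N : ℕ, PolyChaos.IsBestL2Approx N ubar (uLS N) ∧ ContinuousOn (res N) PolyChaos.Ixi) ∧
    (∃ Cinf : ℝ, 0 < Cinf ∧
      ∀ N : ℕ, PolyChaos.normLinf (res N) ≤ ENNReal.ofReal Cinf * PolyChaos.normLinf (err N)) ∧
    (∀ δ : ℝ, 0 < δ →
      PolyChaos.IsBigOPow (fun N => PolyChaos.normLinf (err N)) (3 / 4 + δ - s) ∧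
      PolyChaos.IsBigOPow (fun N => PolyChaos.normLinf (res N)) (3 / 4 + δ - s)) ∧
    (∃ C₂ : ℝ, 0 < C₂ ∧
      ∀ N : ℕ, PolyChaos.normL2 (res N) ≤ ENNReal.ofReal C₂ * PolyChaos.normL2 (err N)) ∧
    PolyChaos.IsBigOPow (fun N => PolyChaos.normL2 (err N)) (-s) ∧
    PolyChaos.IsBigOPow (fun N => PolyChaos.normL2 (res N)) (-s) ∧
    (∀ l : ℕ, Tendsto (fun N => PolyChaos.moment (res N) l) atTop (𝓝 0)) := by
  open PolyChaos in
  intro ubar uLS err res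
  have hubar : ContinuousOn ubar Ixi := continuousOn_reparam hab hu.continuousOn
  have hm : MemLp ubar 2 muI := hubar.memLp_Ixi 2
  have hLS : ∀ N, ContinuousOn (uLS N) Ixi := fun N => (continuous_lsProj hm N).continuousOn
  obtain ⟨A, hA, hAN⟩ := hus.exists_norm_sub_lsProj_le hs hubar
  obtain ⟨B, hB, hBN⟩ := hus.exists_normL2_sub_lsProj_le (by linarith) hm
  -- For N ≥ 2 the uniform error is at most A because 1/2 - s < 0; the two remaining projections are
  -- bounded individually. This makes the Lipschitz constant L independent of N.
  obtain ⟨R, hR, hRN⟩ := exists_forall_norm_le hubar hLS (A := A) (N₀ := 2)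
    fun N hN z hz => (hAN N hN z hz).trans (mul_le_of_le_one_right hA
      (Real.rpow_le_one_of_one_le_of_nonpos (by exact_mod_cast (by omega : 1 ≤ N)) (by linarith)))
  obtain ⟨L, hL, hLip⟩ := hf.locallyLipschitz R hR
  have hres : ∀ N, ∀ z ∈ Ixi, ‖res N z‖ ≤ L * ‖err N z‖ := by
    intro N z hz
    have hμ := param_mem_Icc hab hz
    have h1 := hLip (uLS N z) (ubar z) ((hRN z hz).2 N) (hRN z hz).1 _ hμ
    have h2 : f (ubar z) (paramMean a b + paramStd a b * z) = 0 := hu.steady _ hμ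
    rw [h2, sub_zero, norm_sub_rev (uLS N z)] at h1
    exact h1
  have hinf : ∀ N, normLinf (res N) ≤ ENNReal.ofReal L * normLinf (err N) := fun N =>
    eLpNorm_Ixi_le_mul (hres N) ⊤
  have htwo : ∀ N, normL2 (res N) ≤ ENNReal.ofReal L * normL2 (err N) := fun N =>
    eLpNorm_Ixi_le_mul (hres N) 2
  -- The available exponent 1/2 - s lies below 3/4 + δ - s.
  have hEinf : ∀ δ : ℝ, 0 < δ → IsBigOPow (fun N => normLinf (err N)) (3 / 4 + δ - s) :=
    fun δ hδ => isBigOPow_of_le hA (by linarith) fun N hN => normLinf_le_of_forall (hAN N hN)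
  have hEtwo : IsBigOPow (fun N => normL2 (err N)) (-s) := isBigOPow_of_le hB le_rfl hBN
  refine ⟨fun N => ⟨isBestL2Approx_lsProj hm N, continuousOn_nemytskii hab hf (hLS N)⟩,
    ⟨L, hL, hinf⟩, fun δ hδ => ⟨hEinf δ hδ, (hEinf δ hδ).of_le_mul hL hinf⟩, ⟨L, hL, htwo⟩,
    hEtwo, hEtwo.of_le_mul hL htwo, fun l => ?_⟩
  -- Already at s = 1 the uniform rate decays like N^{-1/2}, so the moments tend to zero by |Φ_l| ≤
  -- 1 and the finite length of the interval.
  have hlim : Tendsto (fun N : ℕ => L * (A * (N : ℝ) ^ (1 / 2 - s)) * volume.real Ixi) atTop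
      (𝓝 0) := by
    have h1 := (tendsto_rpow_neg_atTop (y := s - 1 / 2) (by linarith)).comp
      tendsto_natCast_atTop_atTop
    have h2 := ((h1.const_mul A).const_mul L).mul_const (volume.real Ixi)
    simpa [Function.comp_def, neg_sub] using h2
  refine squeeze_zero_norm' ?_ hlim
  filter_upwards [eventually_ge_atTop 2] with N hN
  refine norm_moment_le (fun z hz => (hres N z hz).trans ?_) l
  exact mul_le_mul_of_nonneg_left (hAN N hN z hz) hL.le
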